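/- **Model.** A dynamic graph $\mathcal G=(V,\mathcal E)$ has an underlying finite simple graph $G=(V,E)$ and, for every time $t\in\mathbb N$, a set $\mathcal E(t)\subseteq E$ of edges present at time $t$; $n=|V|$ and $m=|E|$. For $T\ge 1$ it is $T$-interval-connected if $\bigl(V,\bigcap_{i=t}^{t+T-1}\mathcal E(i)\bigr)$ is connected for every $t$. Every node $v$ has a unique identifier (a natural number), and its $\delta(v)$ incident edges in $G$ are numbered by ports through a bijection $\lambda_v$ from the neighbours of $v$ in $G$ to $\{1,\dots,\delta(v)\}$. In the $KT_1$ model, an agent located at $\nu(t)$ at time $t$ observes the identifier and the degree $\delta(\nu(t))$ of $\nu(t)$, the set of ports of $\nu(t)$ whose edges are present at time $t$, the port through which it arrived (none at time $0$), and the identifiers of all neighbours $v$ of $\nu(t)$ in the graph $(V,\mathcal E(t))$ together with the port numbers $\lambda_{\nu(t)}(v)$. A deterministic algorithm determines from all observations made so far (and nothing else; in particular $n$, $m$ and $T$ are not given) either an available port, through which the agent moves to the corresponding neighbour, so that it is there at time $t+1$, or that the agent terminates. An algorithm explores $\mathcal G$ within $\tau$ time steps if, from every start node, the agent visits all nodes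 and terminates, at a time at most $\tau$. **The algorithm $\mathrm{GreedyExp}_1$.** The agent remembers the set $V_{\mathrm{vis}}$ of visited nodes, the set $V_{\mathrm{map}}$ of nodes that it has visited or observed as neighbours, the port number $\lambda_u(v)$ once it has seen $v$ from $u$ or has arrived at $u$ from $v$, and, for each node $u$, the set $P_{\mathrm{del}}(u)$ of ports of $u$ that were unavailable at some visit of $u$. Call $(u,v)$ usable if $\lambda_u(v)$ is known and not in $P_{\mathrm{del}}(u)$. The graph $G_{\mathrm{map}}$ on $V_{\mathrm{map}}$ has an edge $\{u,v\}$ if $u,v\in V_{\mathrm{vis}}$ and both $(u,v)$ and $(v,u)$ are usable, or if $u\in V_{\mathrm{vis}}$, $v\in V_{\mathrm{map}}\setminus V_{\mathrm{vis}}$ and $(u,v)$ is usable. If $V_{\mathrm{map}}=V_{\mathrm{vis}}$, the agent terminates; otherwise it moves to the next node on a shortest path in $G_{\mathrm{map}}$ from its current node to a closest node of $V_{\mathrm{map}}\setminus V_{\mathrm{vis}}$, ties being broken arbitrarily. **Theorem.** For $n\ge 3$ and $m\ge n$ let $\epsilon(n,m)=\dfrac{\ln n}{1+\ln m-\ln n}$.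 There are a function $\tau$ with positive integer values and a constant $C$ such that $\tau(n,m)\le C\,\bigl(\epsilon(n,m)\,m+n\log_2^2 n\bigr)$ for all $n\ge 3$ and $n\le m\le\binom n2$, and such that the deterministic algorithm $\mathrm{GreedyExp}_1$ (which exists as a function of the agent's observations, and under every way of breaking ties) in the $KT_1$ model explores every $\tau(n,m)$-interval-connected dynamic graph with $n$ nodes and $m$ edges, for all $n\ge 3$ and $n\le m\le\binom n2$, within $\tau(n,m)$ time steps. -/

import Mathlib

namespace DynExp

/-- A dynamic graph on the node set `V`, with node identifiers and port numbers:
`G` is the underlying graph, `E t` is the snapshot at time `t` (a spanning subgraph of `G`),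
`id v` is the unique identifier of `v`, and `port v u` is the port number `λ_v(u)`,
where `λ_v` is a bijection from the neighbours of `v` in `G` onto `{1, …, δ(v)}`
(the values of `port v` outside the neighbourhood of `v` are irrelevant). -/
structure DynGraph (V : Type*) [Fintype V] where
  G : SimpleGraph V
  E : ℕ → SimpleGraph V
  E_le : ∀ t, E t ≤ G
  id : V → ℕ
  id_injective : Function.Injective id
  port : V → V → ℕ
  port_bijOn : ∀ v, Set.BijOn (port v) (G.neighborSet v) (Set.Icc 1 (G.neighborSet v).ncard)

/-- `T`-interval connectivity (for `T ≥ 1`): for every `t`, the intersection of the snapshots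
at times `t, t + 1, …, t + T - 1` is connected. -/
def DynGraph.IntervalConnected {V : Type*} [Fintype V] (𝒢 : DynGraph V) (T : ℕ) : Prop :=
  ∀ t : ℕ, (⨅ i ∈ Set.Ico t (t + T), 𝒢.E i).Connected

/-- What the agent perceives at one time step in the `KT₁` model: the identifier and the degree
(in the underlying graph) of its current node, the set of ports available there now, the port
through which it arrived (`none` at time `0`), and the set of pairs `(id v, λ(v))` where `v`
ranges over the neighbours of the current node in the current snapshot and `λ(v)` is the port
leading to `v`. -/
structure Observation where
  node : ℕ
  degree : ℕ
  ports : Finset ℕ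
  inPort : Option ℕ
  nbrs : Finset (ℕ × ℕ)

/-- A deterministic algorithm for a single agent in the `KT₁` model. From the list of all
observations made so far (in chronological order) it determines the next action: leave through
port `p` (`some p`) or terminate (`none`). -/
abbrev Algorithm : Type := List Observation → Option ℕ

open Classical in
/-- The observation made at time `t` by an agent with trajectory `ν`. -/
noncomputable def DynGraph.obs {V : Type*} [Fintype V] (𝒢 : DynGraph V) (ν : ℕ → V) (t : ℕ) :
    Observation where
  node := 𝒢.id (ν t)
  degree := (𝒢.G.neighborSet (ν t)).ncard
  ports := (Finset.univ.filter fun v => (𝒢.E t).Adj (ν t) v).image fun v => 𝒢.port (ν t) v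
  inPort := if t = 0 then none else some (𝒢.port (ν t) (ν (t - 1)))
  nbrs := (Finset.univ.filter fun v => (𝒢.E t).Adj (ν t) v).image
    fun v => (𝒢.id v, 𝒢.port (ν t) v)

/-- The observations made at times `0, 1, …, t` by an agent with trajectory `ν`. -/
noncomputable def DynGraph.history {V : Type*} [Fintype V] (𝒢 : DynGraph V) (ν : ℕ → V)
    (t : ℕ) : List Observation :=
  (List.range (t + 1)).map (𝒢.obs ν)

/-- `ν 0, …, ν k` is the trajectory of an agent that starts at `s`, runs `A` and terminates at
time `k`: at each time `t < k` it selects a port available at `ν t` at time `t` and moves to the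
neighbour behind that port, and at time `k` it decides to terminate. -/
def IsExecution {V : Type*} [Fintype V] (A : Algorithm) (𝒢 : DynGraph V) (s : V)
    (ν : ℕ → V) (k : ℕ) : Prop :=
  ν 0 = s ∧
  (∀ t < k, (𝒢.E t).Adj (ν t) (ν (t + 1)) ∧
    A (𝒢.history ν t) = some (𝒢.port (ν t) (ν (t + 1)))) ∧
  A (𝒢.history ν k) = none

/-- An agent running `A` from `s` visits all nodes of `𝒢` and terminates, at time at most `τ`. -/
def ExploresWithin {V : Type*} [Fintype V] (A : Algorithm) (𝒢 : DynGraph V) (s : V)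
    (τ : ℕ) : Prop :=
  ∃ (ν : ℕ → V) (k : ℕ), k ≤ τ ∧ IsExecution A 𝒢 s ν k ∧ ∀ v : V, ∃ t ≤ k, ν t = v

/-! ### The agent's map, computed from the list `h` of its observations

Nodes are represented by their identifiers. -/

/-- `V_vis`: the nodes visited so far. -/
def visited (h : List Observation) : Set ℕ := {u | ∃ o ∈ h, o.node = u}

/-- `V_map`: the nodes visited so far or seen so far as a neighbour in a snapshot. -/
def mapped (h : List Observation) : Set ℕ :=
  {u | u ∈ visited h ∨ ∃ o ∈ h, ∃ p, (u, p) ∈ o.nbrs}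

/-- `Λ_map(u, v) = p`: the agent has learned that port `p` of `u` leads to `v`, either by seeing
`v` from `u` or by arriving at `u` from `v`. -/
def LearnedPort (h : List Observation) (u v p : ℕ) : Prop :=
  (∃ o ∈ h, o.node = u ∧ (v, p) ∈ o.nbrs) ∨
  ∃ (i : ℕ) (o o' : Observation), h[i]? = some o ∧ h[i + 1]? = some o' ∧
    o.node = v ∧ o'.node = u ∧ o'.inPort = some p

/-- `P_del(u)`: the ports of `u` that were unavailable at some visit of `u`. -/
def deleted (h : List Observation) (u : ℕ) : Set ℕ :=
  {p | ∃ o ∈ h, o.node = u ∧ p ∈ Set.Icc 1 o.degree ∧ p ∉ o.ports}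

/-- `Λ_map(u, v) ∉ P_del(u) ∪ {⊥}`. -/
def Usable (h : List Observation) (u v : ℕ) : Prop :=
  ∃ p, LearnedPort h u v p ∧ p ∉ deleted h u

/-- `G_map`: two visited nodes are joined if the edge is usable from both endpoints; a visited node
and a mapped unvisited node are joined if the edge is usable from the visited one. -/
def mapGraph (h : List Observation) : SimpleGraph ℕ :=
  SimpleGraph.fromRel fun u v =>
    (u ∈ visited h ∧ v ∈ visited h ∧ Usable h u v ∧ Usable h v u) ∨
    (u ∈ visited h ∧ v ∈ mapped h \ visited h ∧ Usable h u v)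

/-- `A` is an implementation of the algorithm `GreedyExp₁`. If every mapped node is visited, it
terminates. Otherwise it moves to the next node on a shortest path in `G_map` from the current node
to a closest mapped unvisited node; ties are broken arbitrarily. (If no mapped unvisited node can be
reached in `G_map`, such a path does not exist and the action is not prescribed.) -/
def IsGreedyExp₁ (A : Algorithm) : Prop :=
  ∀ (h : List Observation) (o : Observation), h.getLast? = some o →
    (mapped h \ visited h = ∅ → A h = none) ∧
    ((∃ w ∈ mapped h \ visited h, (mapGraph h).Reachable o.node w) →
      ∃ w ∈ mapped h \ visited h, ∃ P : (mapGraph h).Walk o.node w,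
        (∀ w' ∈ mapped h \ visited h, ∀ Q : (mapGraph h).Walk o.node w', P.length ≤ Q.length) ∧
        ∃ p, LearnedPort h o.node P.snd p ∧ A h = some p)

/-- `ε(n, m) = ln n / (1 + ln m - ln n)`. -/
noncomputable def eps (n m : ℕ) : ℝ :=
  Real.log n / (1 + Real.log m - Real.log n)

end DynExp

/-! Let `H` be a connected graph contained in all snapshots of the first window. Call a pair of
nodes trusted if it was adjacent at every visit of either node so far; the edges of `H` stay
trusted. On actual runs the agent's map is the trusted graph near the visited nodes, so each step
follows a shortest trusted path to an unvisited node. Let d be the length of such a path. A step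
should lower d by one, and `excess` measures by how much it fails to. Telescoping bounds the number
of steps by n plus the total excess, so for each level ℓ it suffices to count the steps of excess at
least ℓ.

Steps to new nodes: the nodes reached are pairwise at distance at least ℓ in `H`, since otherwise an
unvisited node would have been close by. A packing argument leaves at most 2n/ℓ of them
(`card_visitSteps_mul_le`).

Steps to old nodes: an edge of the planned path at the new location has been lost, and its ends are
now more than ℓ apart along trusted edges (`exists_lost_edge`). The edges lost at later such steps
are still trusted at that moment. Hence the earliest lost edge on a cycle of lost edges forces the
cycle to be long, and a Moore bound (`ncard_edgeSet_le_of_long_cycles`) limits their number. There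
are three estimates: m for ℓ up to the order of ε; n·√(e·m/n), by the Moore bound, for ℓ up to the
order of log n; and O(n log n / ℓ) beyond, by first contracting along `H` to fewer vertices
(`card_le_of_contraction`). Summed over ℓ they give O(ε m + n log² n), so a run of that length
cannot leave a node unvisited. -/

namespace DynExp

/-! ### Moore bound for graphs without short cycles. -/

section Moore

variable {V : Type*}

/-- A walk can be split at any of its edges. -/
theorem exists_split_of_mem_edges {G : SimpleGraph V} {x y : V} (p : G.Walk x y) {e : Sym2 V}
    (he : e ∈ p.edges) : ∃ (a b : V) (q : G.Walk x a) (r : G.Walk b y), s(a, b) = e ∧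
      p.edges = q.edges ++ e :: r.edges := by
  induction p with
  | nil => simp at he
  | @cons u v w h p ih =>
    by_cases hh : e = s(u, v)
    · exact ⟨u, v, .nil, p, hh.symm, by simp [hh]⟩
    · have : e ∈ p.edges := by simpa [hh] using he
      obtain ⟨a, b, q, r, h1, h2⟩ := ih this
      exact ⟨a, b, .cons h q, r, h1, by simp [h2]⟩

theorem exists_geodesic_avoiding {G : SimpleGraph V} {v x y : V} (hx : G.Reachable v x)
    (hd : G.dist v x ≤ G.dist v y) (hne : x ≠ y) :
    ∃ p : G.Walk v x, p.length = G.dist v x ∧ y ∉ p.support := by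
  classical
  obtain ⟨p, hp⟩ := hx.exists_walk_length_eq_dist
  refine ⟨p, hp, fun hy => hne ?_⟩
  have h1 := SimpleGraph.dist_le (p.takeUntil y hy)
  have h2 := congrArg SimpleGraph.Walk.length (p.take_spec hy)
  rw [SimpleGraph.Walk.length_append] at h2
  exact (SimpleGraph.Walk.eq_of_length_eq_zero (p := p.dropUntil y hy) (by omega)).symm

/-- If all cycles are longer than `2 * r + 2`, a vertex at distance at most `r` from `v` has at most
one neighbour that is not farther away from `v`. -/
theorem eq_of_adj_of_dist_le {G : SimpleGraph V} {r : ℕ}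
    (hG : ∀ a b, G.Adj a b → ∀ p : (G.deleteEdges {s(a, b)}).Walk a b, 2 * r + 2 ≤ p.length)
    {v x x' y : V} (hx : G.Reachable v x) (hx' : G.Reachable v x') (hxy : G.Adj x y)
    (hxy' : G.Adj x' y) (hd : G.dist v x ≤ G.dist v y) (hd' : G.dist v x' ≤ G.dist v y)
    (hr : G.dist v y ≤ r) : x = x' := by
  by_contra hne
  obtain ⟨p, hp, hyp⟩ := exists_geodesic_avoiding hx hd hxy.ne
  obtain ⟨p', hp', hyp'⟩ := exists_geodesic_avoiding hx' hd' hxy'.ne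
  -- Both geodesics avoid y, so this walk bypasses the edge xy; its length is at most 2r + 1, one
  -- less than allowed.
  let q : G.Walk y x := .cons hxy'.symm (p'.reverse.append p)
  have hq : s(y, x) ∉ q.edges := by
    simp only [q, SimpleGraph.Walk.edges_cons, SimpleGraph.Walk.edges_append,
      SimpleGraph.Walk.edges_reverse, List.mem_cons, List.mem_append, List.mem_reverse, not_or]
    refine ⟨fun h => ?_, fun h => hyp' (p'.fst_mem_support_of_mem_edges h),
      fun h => hyp (p.fst_mem_support_of_mem_edges h)⟩
    rcases Sym2.eq_iff.1 h with h | h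
    · exact hne h.2
    · exact hxy.ne h.2
  have := hG y x hxy.symm (q.toDeleteEdge _ hq)
  rw [SimpleGraph.Walk.length_transfer] at this
  simp [q] at this
  omega

variable [Fintype V]

/-- Charge each edge to its endpoint farther from `v`. No vertex is charged twice, since it has at
most one neighbour that is not farther away. -/
theorem ncard_edges_in_ball_le {G : SimpleGraph V} {r : ℕ}
    (hG : ∀ a b, G.Adj a b → ∀ p : (G.deleteEdges {s(a, b)}).Walk a b, 2 * r + 2 ≤ p.length)
    (v : V) :
    {e ∈ G.edgeSet | ∀ z ∈ e, G.Reachable v z ∧ G.dist v z ≤ r}.ncard ≤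
      {z | G.Reachable v z ∧ G.dist v z ≤ r}.ncard := by
  classical
  have key : ∀ e : Sym2 V, ∃ y x, e = s(x, y) ∧ G.dist v x ≤ G.dist v y := by
    intro e
    induction e with
    | h a b =>
      rcases le_total (G.dist v a) (G.dist v b) with h | h
      · exact ⟨b, a, rfl, h⟩
      · exact ⟨a, b, Sym2.eq_swap, h⟩
  choose f g hfg hd using key
  have hf : ∀ e, f e ∈ e := fun e => by
    have : f e ∈ s(g e, f e) := by simp
    rwa [← hfg e] at this
  have hg : ∀ e, g e ∈ e := fun e => by
    have : g e ∈ s(g e, f e) := by simp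
    rwa [← hfg e] at this
  refine Set.ncard_le_ncard_of_injOn f (fun e he => ?_) (fun e he e' he' hee => ?_)
  · exact he.2 _ (hf e)
  · have h1 := hfg e
    have h2 := hfg e'
    have hx := he.2 (g e) (hg e)
    have hy := he.2 (f e) (hf e)
    have hx' := he'.2 (g e') (hg e')
    have ha : G.Adj (g e) (f e) := by rw [← SimpleGraph.mem_edgeSet, ← h1]; exact he.1
    have ha' : G.Adj (g e') (f e') := by rw [← SimpleGraph.mem_edgeSet, ← h2]; exact he'.1
    rw [← hee] at ha'
    have := eq_of_adj_of_dist_le hG hx.1 hx'.1 ha ha' (hd e) (hee ▸ hd e') hy.2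
    rw [h1, h2, this, hee]

/-- A form of the Moore bound: a graph on at most `ρ ^ k` non-isolated vertices all of whose cycles
are longer than `2 * k + 2` has average degree at most `2 * ρ`. -/
theorem ncard_edgeSet_le_of_long_cycles {k : ℕ} (hk : 1 ≤ k) {ρ : ℝ} (hρ : 0 ≤ ρ)
    (G : SimpleGraph V) (hn : (G.support.ncard : ℝ) ≤ ρ ^ k)
    (hG : ∀ a b, G.Adj a b → ∀ p : (G.deleteEdges {s(a, b)}).Walk a b, 2 * k + 2 ≤ p.length) :
    (G.edgeSet.ncard : ℝ) ≤ ρ * G.support.ncard := by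
  classical
  induction hN : G.support.ncard using Nat.strong_induction_on generalizing G with
  | _ N ih =>
  subst hN
  by_cases hbot : G = ⊥
  · subst hbot
    simp only [SimpleGraph.edgeSet_bot, Set.ncard_empty, Nat.cast_zero]
    positivity
  obtain ⟨v, u, hvu⟩ := SimpleGraph.ne_bot_iff_exists_adj.1 hbot
  set B : ℕ → Set V := fun i => {z | G.Reachable v z ∧ G.dist v z ≤ i} with hB
  have hvB : ∀ i, v ∈ B i := fun i => ⟨.refl _, by simp⟩
  have hBsupp : ∀ i, B i ⊆ G.support := by
    intro i z hz
    by_cases hzv : z = v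
    · subst hzv; exact ⟨u, hvu⟩
    · obtain ⟨p⟩ := hz.1.symm
      cases p with
      | nil => exact absurd rfl hzv
      | cons h _ => exact ⟨_, h⟩
  -- If every ball grew by a factor above ρ, the ball of radius k would have more than ρ ^ k
  -- vertices, hence more than the whole support.
  obtain ⟨i, hik, hi⟩ : ∃ i < k, ((B (i + 1)).ncard : ℝ) ≤ ρ * (B i).ncard := by
    by_contra! hcon
    have hgrow : ∀ i ≤ k, ρ ^ i ≤ ((B i).ncard : ℝ) := by
      intro i
      induction i with
      | zero =>
        intro _
        have : 0 < (B 0).ncard := (Set.ncard_pos (Set.toFinite _)).2 ⟨v, hvB 0⟩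
        simpa using (by exact_mod_cast this : (1 : ℝ) ≤ ((B 0).ncard : ℝ))
      | succ i ihi =>
        intro hi
        have h1 := hcon i (by omega)
        have h2 := ihi (by omega)
        rw [pow_succ']
        exact (mul_le_mul_of_nonneg_left h2 hρ).trans h1.le
    obtain ⟨j, rfl⟩ : ∃ j, k = j + 1 := ⟨k - 1, by omega⟩
    have h1 := hcon j (by omega)
    have h2 := mul_le_mul_of_nonneg_left (hgrow j (by omega)) hρ
    have h3 : ((B (j + 1)).ncard : ℝ) ≤ G.support.ncard := by
      exact_mod_cast Set.ncard_le_ncard (hBsupp _) (Set.toFinite _)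
    rw [pow_succ'] at hn
    linarith
  -- Remove the ball `B i` and recurse. The edges destroyed lie inside `B (i + 1)`, so there are at
  -- most |B (i + 1)| ≤ ρ |B i| of them, paid for by the |B i| vertices removed.
  let G' : SimpleGraph V :=
    { Adj := fun a b => G.Adj a b ∧ a ∉ B i ∧ b ∉ B i
      symm := ⟨fun a b h => ⟨h.1.symm, h.2.2, h.2.1⟩⟩
      loopless := ⟨fun a h => h.1.ne rfl⟩ }
  have hG' : G' ≤ G := fun a b h => h.1
  have hsub : G'.support ⊆ G.support \ B i := by
    rintro a ⟨b, hab⟩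
    exact ⟨⟨b, hab.1⟩, hab.2.1⟩
  have hdiff : (G.support \ B i).ncard + (B i).ncard = G.support.ncard :=
    Set.ncard_sdiff_add_ncard_of_subset (hBsupp i)
  have hBpos : 0 < (B i).ncard := (Set.ncard_pos (Set.toFinite _)).2 ⟨v, hvB i⟩
  have hle' : G'.support.ncard ≤ (G.support \ B i).ncard :=
    Set.ncard_le_ncard hsub (Set.toFinite _)
  have hrec := ih G'.support.ncard (by omega) G'
    ((Nat.cast_le.2 (by omega)).trans hn) (by
      intro a b hab p
      have := hG a b hab.1 (p.mapLe (by
        intro c d hcd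
        rw [SimpleGraph.deleteEdges_adj] at hcd ⊢
        exact ⟨hcd.1.1, hcd.2⟩))
      simpa using this) rfl
  have hball : {e ∈ G.edgeSet | ∀ z ∈ e, z ∈ B (i + 1)}.ncard ≤ (B (i + 1)).ncard :=
    ncard_edges_in_ball_le (r := i + 1)
      (fun a b hab p => le_trans (by omega) (hG a b hab p)) v
  have hstep : ∀ a b, G.Adj a b → a ∈ B i → a ∈ B (i + 1) ∧ b ∈ B (i + 1) := by
    intro a b hab ha
    refine ⟨⟨ha.1, ha.2.trans (by omega)⟩, ha.1.trans hab.reachable, ?_⟩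
    obtain ⟨p, hp⟩ := ha.1.exists_walk_length_eq_dist
    have := SimpleGraph.dist_le (p.concat hab)
    rw [SimpleGraph.Walk.length_concat] at this
    have := ha.2
    omega
  have hcover : G.edgeSet ⊆ G'.edgeSet ∪ {e ∈ G.edgeSet | ∀ z ∈ e, z ∈ B (i + 1)} := by
    intro e he
    induction e with
    | h a b =>
      have hab : G.Adj a b := he
      by_cases ha : a ∈ B i
      · right
        refine ⟨he, ?_⟩
        have := hstep a b hab ha
        intro z hz
        rcases Sym2.mem_iff.1 hz with rfl | rfl
        exacts [this.1, this.2]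
      · by_cases hb : b ∈ B i
        · right
          refine ⟨he, ?_⟩
          have := hstep b a hab.symm hb
          intro z hz
          rcases Sym2.mem_iff.1 hz with rfl | rfl
          exacts [this.2, this.1]
        · left
          exact ⟨hab, ha, hb⟩
  have hcard : G.edgeSet.ncard ≤ G'.edgeSet.ncard + (B (i + 1)).ncard :=
    (Set.ncard_le_ncard hcover (Set.toFinite _)).trans
      ((Set.ncard_union_le _ _).trans (by omega))
  have h1 : (G.edgeSet.ncard : ℝ) ≤ G'.edgeSet.ncard + (B (i + 1)).ncard := by
    exact_mod_cast hcard
  have h2 : ρ * (G'.support.ncard : ℝ) ≤ ρ * ((G.support \ B i).ncard : ℝ) :=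
    mul_le_mul_of_nonneg_left (by exact_mod_cast hle') hρ
  have h3 : ((G.support \ B i).ncard : ℝ) + (B i).ncard = G.support.ncard := by
    exact_mod_cast hdiff
  rw [← h3, mul_add]
  linarith

end Moore

/-! ### Edge families in which each edge has distant ends with respect to the later ones. -/

section Ordered

variable {V : Type*}

/-- The graph formed by the edges `a t b t` with `t ∈ s`. -/
def edgeFamily (a b : ℕ → V) (s : Set ℕ) : SimpleGraph V :=
  SimpleGraph.fromEdgeSet {e | ∃ t ∈ s, s(a t, b t) = e}

theorem edgeFamily_adj {a b : ℕ → V} {s : Set ℕ} {u v : V} :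
    (edgeFamily a b s).Adj u v ↔ (∃ t ∈ s, s(a t, b t) = s(u, v)) ∧ u ≠ v := by
  simp [edgeFamily]

/-- If each edge of a family `e₀, e₁, …` joins vertices that are far from each other in the graph
formed by the later edges, then the graph formed by all edges has only long cycles. -/
theorem le_length_of_edgeFamily (D : Finset ℕ) (a b : ℕ → V) (q : ℕ)
    (h : ∀ t ∈ D, ∀ p : (edgeFamily a b {t' ∈ D | t < t'}).Walk (a t) (b t), q ≤ p.length)
    (u v : V) (huv : (edgeFamily a b D).Adj u v)
    (p : ((edgeFamily a b D).deleteEdges {s(u, v)}).Walk u v) : q ≤ p.length := by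
  classical
  have key : ∀ t ∈ D, ∀ (c d : V) (w : (edgeFamily a b D).Walk c d), s(c, d) = s(a t, b t) →
      (∀ e ∈ w.edges, e ≠ s(a t, b t) ∧ ∀ t' ∈ D, s(a t', b t') = e → t ≤ t') → q ≤ w.length := by
    intro t ht c d w hcd hw
    have htr : ∀ e ∈ w.edges, e ∈ (edgeFamily a b {t' ∈ D | t < t'}).edgeSet := by
      intro e he
      have he' := w.edges_subset_edgeSet he
      obtain ⟨h1, h2⟩ := hw e he
      induction e with
      | h x y =>
        rw [SimpleGraph.mem_edgeSet, edgeFamily_adj] at he' ⊢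
        obtain ⟨⟨t', ht', hxy⟩, hne⟩ := he'
        refine ⟨⟨t', ⟨ht', lt_of_le_of_ne (h2 t' ht' hxy) ?_⟩, hxy⟩, hne⟩
        rintro rfl
        exact h1 hxy.symm
    rcases Sym2.eq_iff.1 hcd with ⟨rfl, rfl⟩ | ⟨rfl, rfl⟩
    · simpa using h t ht (w.transfer _ htr)
    · simpa using h t ht (w.transfer _ htr).reverse
  have hp := p.bypass_isPath
  have hlen := p.length_bypass_le_length
  generalize p.bypass = r at hp hlen
  refine le_trans ?_ hlen
  have hr : ∀ e ∈ r.edges, e ∈ (edgeFamily a b D).edgeSet ∧ e ≠ s(u, v) := by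
    intro e he
    have := r.edges_subset_edgeSet he
    simpa [SimpleGraph.edgeSet_deleteEdges] using this
  let w := r.transfer (edgeFamily a b D) fun e he => (hr e he).1
  have hw : w.edges = r.edges := r.edges_transfer _
  have hwl : w.length = r.length := r.length_transfer _
  have hnd : w.edges.Nodup := hw ▸ hp.isTrail.edges_nodup
  rw [← hwl]
  have hwne : ∀ e ∈ w.edges, e ≠ s(u, v) := fun e he => (hr e (hw ▸ he)).2
  clear_value w
  -- The path `w` and the edge uv form a cycle; pick the earliest index among its edges. All other
  -- edges of the cycle come later, so the hypothesis applies to the rest of the cycle.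
  let T : Finset ℕ := D.filter fun t => s(a t, b t) = s(u, v) ∨ s(a t, b t) ∈ w.edges
  have hT : T.Nonempty := by
    obtain ⟨⟨t, ht, hte⟩, _⟩ := edgeFamily_adj.1 huv
    exact ⟨t, Finset.mem_filter.2 ⟨ht, .inl hte⟩⟩
  obtain ⟨t, htT, htmin⟩ := T.exists_min_image id hT
  obtain ⟨htD, ht⟩ := Finset.mem_filter.1 htT
  have hmin : ∀ t' ∈ D, (s(a t', b t') = s(u, v) ∨ s(a t', b t') ∈ w.edges) → t ≤ t' :=
    fun t' h1 h2 => htmin t' (Finset.mem_filter.2 ⟨h1, h2⟩)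
  by_cases hte : s(a t, b t) = s(u, v)
  · exact key t htD u v w hte.symm fun e he =>
      ⟨hte ▸ hwne e he, fun t' ht' h' => hmin t' ht' (.inr (h' ▸ he))⟩
  · have htw := ht.resolve_left hte
    obtain ⟨c, d, w₁, w₂, hcd, hsplit⟩ := exists_split_of_mem_edges w htw
    -- The same cycle, opened at its earliest edge instead of at uv; the length does not change.
    let w' : (edgeFamily a b D).Walk c d := w₁.reverse.append (.cons huv w₂.reverse)
    have hl : w'.length = w.length := by
      have := congrArg List.length hsplit
      simp only [SimpleGraph.Walk.length_edges, List.length_append, List.length_cons] at this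
      simp [w']
      omega
    rw [← hl]
    rw [hsplit] at hnd
    refine key t htD c d w' hcd fun e he => ?_
    have he' : e = s(u, v) ∨ e ∈ w₁.edges ∨ e ∈ w₂.edges := by
      simp only [w', SimpleGraph.Walk.edges_append, SimpleGraph.Walk.edges_reverse,
        SimpleGraph.Walk.edges_cons, List.mem_append, List.mem_reverse, List.mem_cons] at he
      tauto
    constructor
    · rintro rfl
      rw [List.nodup_append] at hnd
      rcases he' with h' | h' | h'
      · exact hte h'
      · exact hnd.2.2 _ h' _ (by simp) rfl
      · exact (List.nodup_cons.1 hnd.2.1).1 h'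
    · intro t' ht' h'
      refine hmin t' ht' ?_
      rw [h', hsplit]
      rcases he' with h' | h' | h'
      · exact .inl h'
      · exact .inr (by simp [h'])
      · exact .inr (by simp [h'])

variable [Fintype V]

/-- Different indices give different edges, because a repetition would join the ends by a later walk
of length one. So `D` is counted by edges, and the Moore bound applies. -/
theorem card_le_of_edgeFamily (D : Finset ℕ) (a b : ℕ → V) {k : ℕ} (hk : 1 ≤ k) {ρ : ℝ}
    (hρ : 0 ≤ ρ)
    (h : ∀ t ∈ D, ∀ p : (edgeFamily a b {t' ∈ D | t < t'}).Walk (a t) (b t),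
      2 * k + 2 ≤ p.length) {N : ℕ} (C : Set V) (hC : C.ncard ≤ N)
    (ha : ∀ t, a t ∈ C) (hb : ∀ t, b t ∈ C) (hN : (N : ℝ) ≤ ρ ^ k) :
    (D.card : ℝ) ≤ ρ * N := by
  classical
  have hne : ∀ t ∈ D, a t ≠ b t := by
    intro t ht hab
    have := h t ht ((SimpleGraph.Walk.nil' (a t)).copy rfl hab)
    simp at this
  have hinj : ∀ t ∈ D, ∀ t' ∈ D, t < t' → s(a t, b t) ≠ s(a t', b t') := by
    intro t ht t' ht' hlt heq
    have hadj : (edgeFamily a b {t' ∈ D | t < t'}).Adj (a t) (b t) :=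
      edgeFamily_adj.2 ⟨⟨t', ⟨ht', hlt⟩, heq.symm⟩, hne t ht⟩
    have := h t ht hadj.toWalk
    simp at this
  have hsupp : (edgeFamily a b D).support ⊆ C := by
    rintro x ⟨y, hxy⟩
    obtain ⟨⟨t, _, ht⟩, _⟩ := edgeFamily_adj.1 hxy
    rcases Sym2.eq_iff.1 ht with ⟨rfl, _⟩ | ⟨_, rfl⟩
    exacts [ha t, hb t]
  have hsN : (edgeFamily a b (D : Set ℕ)).support.ncard ≤ N :=
    (Set.ncard_le_ncard hsupp (Set.toFinite _)).trans hC
  have hsN' : ((edgeFamily a b (D : Set ℕ)).support.ncard : ℝ) ≤ N := by exact_mod_cast hsN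
  have hcard : D.card ≤ (edgeFamily a b (D : Set ℕ)).edgeSet.ncard := by
    rw [← Set.ncard_coe_finset]
    refine Set.ncard_le_ncard_of_injOn (fun t => s(a t, b t)) (fun t ht => ?_)
      (fun t ht t' ht' heq => ?_) (Set.toFinite _)
    · exact edgeFamily_adj.2 ⟨⟨t, ht, rfl⟩, hne t ht⟩
    · rcases lt_trichotomy t t' with hlt | hlt | hlt
      · exact absurd heq (hinj t ht t' ht' hlt)
      · exact hlt
      · exact absurd heq.symm (hinj t' ht' t ht hlt)
  have h1 := ncard_edgeSet_le_of_long_cycles hk hρ _ (hsN'.trans hN)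
    (le_length_of_edgeFamily D a b _ h)
  calc (D.card : ℝ) ≤ (edgeFamily a b (D : Set ℕ)).edgeSet.ncard := by exact_mod_cast hcard
    _ ≤ _ := h1
    _ ≤ ρ * N := mul_le_mul_of_nonneg_left hsN' hρ

/-- Let `W t` contain all edges `x t' y t'` with `t' > t`, and let all walks in `W t` from `x t`
to `y t` be long. After contraction along short walks of `W t`, the graph formed by the edges
`x t y t` obeys the Moore bound. -/
theorem card_le_of_contraction (D : Finset ℕ) (W : ℕ → SimpleGraph V) (x y : ℕ → V) (γ : V → V)
    {k σ L : ℕ} (hk : 1 ≤ k) {ρ : ℝ} (hρ : 0 ≤ ρ) {N : ℕ} (hγ : (Set.range γ).ncard ≤ N)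
    (hN : (N : ℝ) ≤ ρ ^ k) (hcon : ∀ t ∈ D, ∀ v, ∃ p : (W t).Walk v (γ v), p.length ≤ σ)
    (hlater : ∀ t ∈ D, ∀ t' ∈ D, t < t' → (W t).Adj (x t') (y t'))
    (hL : ∀ t ∈ D, ∀ p : (W t).Walk (x t) (y t), L ≤ p.length)
    (hkL : (2 * k + 2) * (2 * σ + 1) ≤ L) : (D.card : ℝ) ≤ ρ * N := by
  refine card_le_of_edgeFamily D (fun t => γ (x t)) (fun t => γ (y t)) hk hρ ?_ (Set.range γ) hγ
    (fun t => ⟨_, rfl⟩) (fun t => ⟨_, rfl⟩) hN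
  intro t ht p
  -- Each contracted edge lifts to an original edge with a contraction walk at either end, hence to
  -- at most 2σ + 1 edges.
  have lift : ∀ (u v : V) (p : (edgeFamily (fun t => γ (x t)) (fun t => γ (y t))
      {t' ∈ D | t < t'}).Walk u v), ∃ q : (W t).Walk u v, q.length ≤ p.length * (2 * σ + 1) := by
    intro u v p
    induction p with
    | nil => exact ⟨.nil, by simp⟩
    | @cons u v w h p ih =>
      obtain ⟨q, hq⟩ := ih
      obtain ⟨⟨t', ⟨ht', hlt⟩, he⟩, _⟩ := edgeFamily_adj.1 h
      obtain ⟨p₁, h₁⟩ := hcon t ht (x t')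
      obtain ⟨p₂, h₂⟩ := hcon t ht (y t')
      have hadj := hlater t ht t' ht' hlt
      have : ∃ r : (W t).Walk u v, r.length ≤ 2 * σ + 1 := by
        rcases Sym2.eq_iff.1 he with ⟨rfl, rfl⟩ | ⟨rfl, rfl⟩
        · exact ⟨p₁.reverse.append (.cons hadj p₂), by simp; omega⟩
        · exact ⟨p₂.reverse.append (.cons hadj.symm p₁), by simp; omega⟩
      obtain ⟨r, hr⟩ := this
      refine ⟨r.append q, ?_⟩
      rw [SimpleGraph.Walk.length_append, SimpleGraph.Walk.length_cons, add_mul]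
      omega
  obtain ⟨q, hq⟩ := lift _ _ p
  obtain ⟨p₁, h₁⟩ := hcon t ht (x t)
  obtain ⟨p₂, h₂⟩ := hcon t ht (y t)
  -- If `p` had at most 2k + 1 edges, the total would be at most (2k + 1)(2σ + 1) + 2σ, which is
  -- less than L.
  have := hL t ht (p₁.append (q.append p₂.reverse))
  simp only [SimpleGraph.Walk.length_append, SimpleGraph.Walk.length_reverse] at this
  by_contra hlt
  have h3 : p.length * (2 * σ + 1) ≤ (2 * k + 1) * (2 * σ + 1) :=
    Nat.mul_le_mul_right _ (by omega)
  have h4 : (2 * k + 2) * (2 * σ + 1) = (2 * k + 1) * (2 * σ + 1) + (2 * σ + 1) := by ring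
  omega

end Ordered

/-! ### Packing and covering in connected graphs. -/

section Separated

variable {V : Type*}

/-- A discrete intermediate value property: along a walk from `w` to `u` the distance to `u` changes
by at most one per step. -/
theorem exists_dist_eq_of_le {H : SimpleGraph V} (hH : H.Connected) {u w : V} {i : ℕ}
    (h : i ≤ H.dist u w) : ∃ z, H.dist u z = i := by
  obtain ⟨p, -⟩ := hH.exists_walk_length_eq_dist w u
  induction p with
  | nil => exact ⟨_, le_antisymm (by simp) h⟩
  | @cons a b c hab p ih =>
    by_cases hb : i ≤ H.dist c b
    · exact ih hb
    · refine ⟨a, le_antisymm ?_ h⟩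
      have h1 := hH.dist_triangle (u := c) (v := b) (w := a)
      have h2 := SimpleGraph.dist_eq_one_iff_adj.2 hab.symm
      omega

variable [Fintype V]

theorem le_card_ball {H : SimpleGraph V} (hH : H.Connected) (u : V) {r : ℕ}
    (hr : r + 1 ≤ Fintype.card V) :
    r + 1 ≤ {z | H.dist u z ≤ r}.ncard := by
  by_cases hall : ∃ w, r ≤ H.dist u w
  · obtain ⟨w, hw⟩ := hall
    have : Set.Iic r ⊆ H.dist u '' {z | H.dist u z ≤ r} := by
      intro i hi
      obtain ⟨z, hz⟩ := exists_dist_eq_of_le hH (le_trans hi hw)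
      exact ⟨z, by rw [Set.mem_ofPred_eq, hz]; exact hi, hz⟩
    have h1 := Set.ncard_le_ncard this (Set.toFinite _)
    have h2 := Set.ncard_image_le (f := H.dist u) (Set.toFinite {z | H.dist u z ≤ r})
    have h3 : (Set.Iic r).ncard = r + 1 := by
      rw [← Finset.coe_Iic, Set.ncard_coe_finset, Nat.card_Iic]
    omega
  · push Not at hall
    have : {z | H.dist u z ≤ r} = Set.univ := Set.eq_univ_of_forall fun z => (hall z).le
    rw [this, Set.ncard_univ, Nat.card_eq_fintype_card]
    exact hr

/-- A set of vertices with pairwise distances at least `ℓ` in a connected graph with `n ≥ ℓ`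
vertices has at most `2 * n / ℓ` elements. -/
theorem card_mul_le_of_separated {H : SimpleGraph V} (hH : H.Connected) (S : Finset V) {ℓ : ℕ}
    (hℓ : ℓ ≤ Fintype.card V)
    (hS : ∀ u ∈ S, ∀ v ∈ S, u ≠ v → ℓ ≤ H.dist u v) : S.card * ℓ ≤ 2 * Fintype.card V := by
  classical
  rcases Nat.eq_zero_or_pos ℓ with rfl | hpos
  · simp
  -- With r = ⌊(ℓ - 1)/2⌋, 2r < ℓ makes the balls disjoint, while 2(r + 1) ≥ ℓ makes each contain at
  -- least ℓ/2 vertices.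
  let B : V → Finset V := fun u => Finset.univ.filter fun z => H.dist u z ≤ (ℓ - 1) / 2
  have hB : ∀ u ∈ S, (ℓ - 1) / 2 + 1 ≤ (B u).card := by
    intro u _
    have := le_card_ball hH u (r := (ℓ - 1) / 2) (by omega)
    rwa [← Set.ncard_coe_finset, Finset.coe_filter_univ]
  have hdisj : (S : Set V).PairwiseDisjoint B := by
    intro u hu v hv huv
    rw [Function.onFun, Finset.disjoint_left]
    intro z hz hz'
    simp only [B, Finset.mem_filter, Finset.mem_univ, true_and] at hz hz'
    have h1 := hH.dist_triangle (u := u) (v := z) (w := v)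
    rw [SimpleGraph.dist_comm (u := z)] at h1
    have := hS u hu v hv huv
    omega
  have h1 := Finset.card_biUnion hdisj
  have h2 := Finset.sum_le_sum hB
  have h3 := Finset.card_le_univ (S.biUnion B)
  rw [Finset.sum_const, smul_eq_mul] at h2
  have h4 : S.card * ℓ ≤ S.card * (2 * ((ℓ - 1) / 2 + 1)) := Nat.mul_le_mul_left _ (by omega)
  have h5 : S.card * (2 * ((ℓ - 1) / 2 + 1)) = 2 * (S.card * ((ℓ - 1) / 2 + 1)) := by ring
  omega

/-- The vertices of a connected graph can be moved along walks of length at most `σ` into a set of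
at most `2 * n / (σ + 1)` vertices. -/
theorem exists_contraction {H : SimpleGraph V} (hH : H.Connected) {σ : ℕ}
    (hσ : σ + 1 ≤ Fintype.card V) :
    ∃ γ : V → V, (Set.range γ).ncard * (σ + 1) ≤ 2 * Fintype.card V ∧
      ∀ v, ∃ p : H.Walk v (γ v), p.length ≤ σ := by
  classical
  let P : Finset V → Prop := fun S => ∀ u ∈ S, ∀ v ∈ S, u ≠ v → σ + 1 ≤ H.dist u v
  -- A maximal (σ + 1)-separated set is within distance σ of every vertex.
  obtain ⟨S, hS⟩ := (Set.toFinite {S | P S}).exists_maximal ⟨∅, by simp [P]⟩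
  have hnear : ∀ v, ∃ u ∈ S, H.dist v u ≤ σ := by
    intro v
    by_contra! hfar
    have : P (insert v S) := by
      intro u hu w hw huw
      rcases Finset.mem_insert.1 hu with rfl | hu'
      · rcases Finset.mem_insert.1 hw with rfl | hw
        · exact absurd rfl huw
        · exact hfar w hw
      · rcases Finset.mem_insert.1 hw with rfl | hw
        · rw [SimpleGraph.dist_comm]; exact hfar u hu'
        · exact hS.1 u hu' w hw huw
    have hv : v ∈ S := hS.2 this (Finset.subset_insert _ _) (Finset.mem_insert_self _ _)
    have := hfar v hv
    simp at this
  choose γ hγS hγ using hnear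
  refine ⟨γ, ?_, fun v => ?_⟩
  · have h1 : (Set.range γ).ncard ≤ S.card := by
      rw [← Set.ncard_coe_finset]
      exact Set.ncard_le_ncard (Set.range_subset_iff.2 hγS) (Set.toFinite _)
    exact (Nat.mul_le_mul_right _ h1).trans (card_mul_le_of_separated hH S hσ hS.1)
  · obtain ⟨p, hp⟩ := hH.exists_walk_length_eq_dist v (γ v)
    exact ⟨p, hp ▸ hγ v⟩

end Separated

/-! ### Greedy runs: the frontier distance as a potential, and counts of bad steps. -/

section Dynamics

variable {V : Type*}

/-- The nodes visited up to time `t`. -/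
def seen (ν : ℕ → V) (t : ℕ) : Set V := {v | ∃ i ≤ t, ν i = v}

/-- The pairs of nodes that were adjacent at every visit up to time `t` of one of them. -/
def trusted (E : ℕ → SimpleGraph V) (ν : ℕ → V) (t : ℕ) : SimpleGraph V where
  -- Two unvisited nodes are adjacent vacuously. This is harmless: a path from a visited node can be
  -- cut at its first unvisited node.
  Adj u v := u ≠ v ∧ ∀ i ≤ t, (ν i = u ∨ ν i = v) → (E i).Adj u v
  symm := ⟨fun _ _ h => ⟨h.1.symm, fun i hi h' => (h.2 i hi h'.symm).symm⟩⟩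
  loopless := ⟨fun _ h => h.1 rfl⟩

/-- An unvisited node can be reached from `a` by at most `q` trusted edges. -/
def Near (E : ℕ → SimpleGraph V) (ν : ℕ → V) (t : ℕ) (a : V) (q : ℕ) : Prop :=
  ∃ w ∉ seen ν t, ∃ p : (trusted E ν t).Walk a w, p.length ≤ q

/-- The distance along trusted edges from the agent to an unvisited node. -/
noncomputable def frontierDist (E : ℕ → SimpleGraph V) (ν : ℕ → V) (t : ℕ) : ℕ :=
  sInf {q | Near E ν t (ν t) q}

/-- `ν 0, …, ν K` always moves along a shortest trusted path to an unvisited node, `H` is contained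
in all snapshots, and some node is unvisited at time `K`. -/
structure GreedyRun (E : ℕ → SimpleGraph V) (H : SimpleGraph V) (ν : ℕ → V) (K : ℕ) : Prop where
  conn : H.Connected
  le : ∀ t ≤ K, H ≤ E t
  unseen : ∃ w, w ∉ seen ν K
  adj : ∀ t < K, (trusted E ν t).Adj (ν t) (ν (t + 1))
  greedy : ∀ t < K, ∃ q, Near E ν t (ν (t + 1)) q ∧ ∀ q', Near E ν t (ν t) q' → q + 1 ≤ q'

theorem seen_mono (ν : ℕ → V) {s t : ℕ} (h : s ≤ t) : seen ν s ⊆ seen ν t :=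
  fun _ ⟨i, hi, hv⟩ => ⟨i, hi.trans h, hv⟩

theorem mem_seen (ν : ℕ → V) (t : ℕ) : ν t ∈ seen ν t := ⟨t, le_rfl, rfl⟩

theorem trusted_anti (E : ℕ → SimpleGraph V) (ν : ℕ → V) {s t : ℕ} (h : s ≤ t) :
    trusted E ν t ≤ trusted E ν s :=
  fun _ _ hab => ⟨hab.1, fun i hi => hab.2 i (hi.trans h)⟩

theorem seen_succ_of_mem {ν : ℕ → V} {t : ℕ} (h : ν (t + 1) ∈ seen ν t) :
    seen ν (t + 1) = seen ν t := by
  refine Set.Subset.antisymm ?_ (seen_mono ν t.le_succ)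
  rintro v ⟨i, hi, rfl⟩
  rcases Nat.lt_or_ge t i with hlt | hge
  · obtain rfl : i = t + 1 := by omega
    exact h
  · exact ⟨i, hge, rfl⟩

/-- A trusted walk either remains trusted after the next step or passes through the next node. -/
theorem walk_trusted_succ_or (E : ℕ → SimpleGraph V) (ν : ℕ → V) (t : ℕ) {a w : V}
    (p : (trusted E ν t).Walk a w) :
    (∃ q : (trusted E ν (t + 1)).Walk a w, q.length ≤ p.length) ∨
      ∃ q : (trusted E ν t).Walk (ν (t + 1)) w, q.length ≤ p.length := by
  induction p with
  | nil => exact .inl ⟨.nil, le_rfl⟩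
  | @cons a b w h p ih =>
    by_cases ha : ν (t + 1) = a
    · subst ha
      exact .inr ⟨.cons h p, le_rfl⟩
    by_cases hb : ν (t + 1) = b
    · subst hb
      exact .inr ⟨p, by simp⟩
    rcases ih with ⟨q, hq⟩ | ⟨q, hq⟩
    · have hab : (trusted E ν (t + 1)).Adj a b := by
        refine ⟨h.1, fun i hi hi' => ?_⟩
        rcases Nat.lt_or_ge t i with hlt | hge
        · obtain rfl : i = t + 1 := by omega
          exact absurd hi' (by simp [ha, hb])
        · exact h.2 i hge hi'
      exact .inl ⟨.cons hab q, by simpa using hq⟩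
    · exact .inr ⟨q, by rw [SimpleGraph.Walk.length_cons]; omega⟩

namespace GreedyRun

variable {E : ℕ → SimpleGraph V} {H : SimpleGraph V} {ν : ℕ → V} {K : ℕ}

theorem le_trusted (h : GreedyRun E H ν K) {t : ℕ} (ht : t ≤ K) : H ≤ trusted E ν t :=
  fun _ _ hab => ⟨hab.ne, fun i hi _ => h.le i (hi.trans ht) hab⟩

theorem near_of_walk (h : GreedyRun E H ν K) {t : ℕ} (ht : t ≤ K) {a w : V} (p : H.Walk a w)
    (hw : w ∉ seen ν t) : Near E ν t a p.length :=
  ⟨w, hw, p.mapLe (h.le_trusted ht), by simp⟩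

theorem frontierDist_le {t q : ℕ} (hq : Near E ν t (ν t) q) : frontierDist E ν t ≤ q :=
  Nat.sInf_le hq

theorem frontierDist_le_succ (h : GreedyRun E H ν K) {t q : ℕ} (ht : t < K)
    (hq : Near E ν t (ν (t + 1)) q) : frontierDist E ν t ≤ q + 1 := by
  obtain ⟨w, hw, p, hp⟩ := hq
  exact frontierDist_le ⟨w, hw, .cons (h.adj t ht) p, by simpa using hp⟩

variable [Fintype V]

theorem near_card (h : GreedyRun E H ν K) {t : ℕ} (ht : t ≤ K) (a : V) :
    Near E ν t a (Fintype.card V - 1) := by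
  obtain ⟨w, hw⟩ := h.unseen
  obtain ⟨p, hp⟩ := (h.conn.preconnected a w).exists_isPath
  obtain ⟨z, hz, q, hq⟩ := h.near_of_walk ht p fun hh => hw (seen_mono ν ht hh)
  have := hp.length_lt
  exact ⟨z, hz, q, by omega⟩

theorem near_frontierDist (h : GreedyRun E H ν K) {t : ℕ} (ht : t ≤ K) :
    Near E ν t (ν t) (frontierDist E ν t) :=
  Nat.sInf_mem (s := {q | Near E ν t (ν t) q}) ⟨_, h.near_card ht _⟩

theorem frontierDist_pos (h : GreedyRun E H ν K) {t : ℕ} (ht : t ≤ K) :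
    1 ≤ frontierDist E ν t := by
  obtain ⟨w, hw, p, hp⟩ := h.near_frontierDist ht
  by_contra hlt
  have := SimpleGraph.Walk.eq_of_length_eq_zero (p := p) (by omega)
  exact hw (this ▸ mem_seen ν t)

theorem frontierDist_lt_card (h : GreedyRun E H ν K) {t : ℕ} (ht : t ≤ K) :
    frontierDist E ν t < Fintype.card V := by
  have := frontierDist_le (h.near_card ht (ν t))
  have := h.frontierDist_pos ht
  omega

theorem near_succ (h : GreedyRun E H ν K) {t : ℕ} (ht : t < K) :
    Near E ν t (ν (t + 1)) (frontierDist E ν t - 1) := by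
  obtain ⟨q, ⟨w, hw, p, hp⟩, hq⟩ := h.greedy t ht
  have := hq _ (h.near_frontierDist ht.le)
  exact ⟨w, hw, p, by omega⟩

end GreedyRun

/-- The amount by which the frontier distance after step `t` exceeds its expected value. -/
noncomputable def excess (E : ℕ → SimpleGraph V) (ν : ℕ → V) (t : ℕ) : ℕ :=
  frontierDist E ν (t + 1) + 1 - frontierDist E ν t

open Classical in
/-- The steps to a new node after which the excess is at least `ℓ`. -/
noncomputable def visitSteps (E : ℕ → SimpleGraph V) (ν : ℕ → V) (K ℓ : ℕ) : Finset ℕ :=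
  {t ∈ Finset.range K | ν (t + 1) ∉ seen ν t ∧ ℓ ≤ excess E ν t}

open Classical in
/-- The steps to a node visited before after which the excess is at least `ℓ`. -/
noncomputable def detourSteps (E : ℕ → SimpleGraph V) (ν : ℕ → V) (K ℓ : ℕ) : Finset ℕ :=
  {t ∈ Finset.range K | ν (t + 1) ∈ seen ν t ∧ ℓ ≤ excess E ν t}

theorem mem_visitSteps {E : ℕ → SimpleGraph V} {ν : ℕ → V} {K ℓ t : ℕ} :
    t ∈ visitSteps E ν K ℓ ↔ t < K ∧ ν (t + 1) ∉ seen ν t ∧ ℓ ≤ excess E ν t := by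
  simp [visitSteps]

theorem mem_detourSteps {E : ℕ → SimpleGraph V} {ν : ℕ → V} {K ℓ t : ℕ} :
    t ∈ detourSteps E ν K ℓ ↔ t < K ∧ ν (t + 1) ∈ seen ν t ∧ ℓ ≤ excess E ν t := by
  simp [detourSteps]

namespace GreedyRun

variable {E : ℕ → SimpleGraph V} {H : SimpleGraph V} {ν : ℕ → V} {K : ℕ}

theorem add_frontierDist_le (k : ℕ) :
    k + frontierDist E ν k ≤ frontierDist E ν 0 + ∑ t ∈ Finset.range k, excess E ν t := by
  induction k with
  | zero => simp
  | succ k ih =>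
    rw [Finset.sum_range_succ]
    have : excess E ν k = frontierDist E ν (k + 1) + 1 - frontierDist E ν k := rfl
    omega

variable [Fintype V]

theorem excess_le_frontierDist (h : GreedyRun E H ν K) {t : ℕ} (ht : t < K) :
    excess E ν t ≤ frontierDist E ν (t + 1) := by
  have := h.frontierDist_pos ht.le
  unfold excess
  omega

/-- Layer-cake summation of the excess. Levels up to n suffice, as the excess is at most the next
frontier distance, which is below n. -/
theorem le_sum_card (h : GreedyRun E H ν K) :
    K ≤ Fintype.card V + ∑ ℓ ∈ Finset.Icc 1 (Fintype.card V),
      ((visitSteps E ν K ℓ).card + (detourSteps E ν K ℓ).card) := by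
  classical
  have h1 := add_frontierDist_le (E := E) (ν := ν) K
  have h2 := h.frontierDist_lt_card (Nat.zero_le K)
  have h3 : ∑ t ∈ Finset.range K, excess E ν t = ∑ ℓ ∈ Finset.Icc 1 (Fintype.card V),
      ((visitSteps E ν K ℓ).card + (detourSteps E ν K ℓ).card) := by
    have h4 : ∀ ℓ, (visitSteps E ν K ℓ).card + (detourSteps E ν K ℓ).card =
        ∑ t ∈ Finset.range K, if ℓ ≤ excess E ν t then 1 else 0 := by
      intro ℓ
      rw [← Finset.card_filter, ← Finset.card_union_of_disjoint]
      · congr 1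
        ext t
        simp only [visitSteps, detourSteps, Finset.mem_union, Finset.mem_filter]
        tauto
      · rw [Finset.disjoint_left]
        intro t ht ht'
        exact (mem_visitSteps.1 ht).2.1 (mem_detourSteps.1 ht').2.1
    simp_rw [h4]
    rw [Finset.sum_comm]
    refine Finset.sum_congr rfl fun t ht => ?_
    have ht := Finset.mem_range.1 ht
    have h5 := h.excess_le_frontierDist ht
    have h6 := h.frontierDist_lt_card (t := t + 1) ht
    rw [← Finset.card_filter]
    have : {ℓ ∈ Finset.Icc 1 (Fintype.card V) | ℓ ≤ excess E ν t} =
        Finset.Icc 1 (excess E ν t) := by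
      ext ℓ
      simp only [Finset.mem_filter, Finset.mem_Icc]
      omega
    rw [this, Nat.card_Icc]
    omega
  omega

/-- A node first reached at a later counted step is still unvisited now, so its `H`-distance from
the current node is at least the frontier distance, hence at least ℓ. -/
theorem card_visitSteps_mul_le (h : GreedyRun E H ν K) {ℓ : ℕ} (hℓ : 1 ≤ ℓ)
    (hn : ℓ ≤ Fintype.card V) :
    (visitSteps E ν K ℓ).card * ℓ ≤ 2 * Fintype.card V := by
  classical
  have key : ∀ t ∈ visitSteps E ν K ℓ, ∀ t' ∈ visitSteps E ν K ℓ, t < t' →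
      ℓ ≤ H.dist (ν (t + 1)) (ν (t' + 1)) := by
    intro t ht t' ht' hlt
    obtain ⟨htK, -, hinc⟩ := mem_visitSteps.1 ht
    obtain ⟨-, hnew, -⟩ := mem_visitSteps.1 ht'
    obtain ⟨p, hp⟩ := h.conn.exists_walk_length_eq_dist (ν (t + 1)) (ν (t' + 1))
    rw [← hp]
    exact (hinc.trans (h.excess_le_frontierDist htK)).trans
      (frontierDist_le (h.near_of_walk htK p fun hh => hnew (seen_mono ν hlt hh)))
  have hne : ∀ t ∈ visitSteps E ν K ℓ, ∀ t' ∈ visitSteps E ν K ℓ, t < t' →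
      ν (t + 1) ≠ ν (t' + 1) := by
    intro t ht t' ht' hlt heq
    have := key t ht t' ht' hlt
    rw [heq, SimpleGraph.dist_self] at this
    omega
  have hinj : Set.InjOn (fun t => ν (t + 1)) (visitSteps E ν K ℓ) := by
    intro t ht t' ht' heq
    rcases lt_trichotomy t t' with hlt | hlt | hlt
    · exact absurd heq (hne t ht t' ht' hlt)
    · exact hlt
    · exact absurd heq.symm (hne t' ht' t ht hlt)
  rw [← Finset.card_image_of_injOn hinj]
  refine card_mul_le_of_separated h.conn _ hn ?_
  intro u hu v hv huv
  obtain ⟨t, ht, rfl⟩ := Finset.mem_image.1 hu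
  obtain ⟨t', ht', rfl⟩ := Finset.mem_image.1 hv
  rcases lt_trichotomy t t' with hlt | rfl | hlt
  · exact key t ht t' ht' hlt
  · exact absurd rfl huv
  · rw [SimpleGraph.dist_comm]
    exact key t' ht' t ht hlt

/-- A detour is caused by the loss of a trusted edge `x y` at the new location `x` of the agent,
whose ends are far from each other afterwards. -/
theorem exists_lost_edge (h : GreedyRun E H ν K) {t : ℕ} (ht : t < K)
    (hold : ν (t + 1) ∈ seen ν t) :
    ∃ y, (trusted E ν t).Adj (ν (t + 1)) y ∧
      ∀ p : (trusted E ν (t + 1)).Walk (ν (t + 1)) y, excess E ν t + 1 ≤ p.length := by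
  obtain ⟨w, hw, p, hp⟩ := h.near_succ ht
  have hpos := h.frontierDist_pos ht.le
  cases p with
  | nil => exact absurd hold hw
  | @cons _ y _ hxy p =>
    rw [SimpleGraph.Walk.length_cons] at hp
    refine ⟨y, hxy, fun q => ?_⟩
    have hq : 1 ≤ q.length := by
      by_contra hlt
      exact hxy.ne (SimpleGraph.Walk.eq_of_length_eq_zero (p := q) (by omega))
    -- Only edges at the new location can lose trust. If the rest of the planned path survives,
    -- reconnecting to it via `q` bounds the new frontier distance; if it returns to the new
    -- location, the planned path was not shortest.
    rcases walk_trusted_succ_or E ν t p with ⟨r, hr⟩ | ⟨r, hr⟩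
    · have := frontierDist_le (E := E) (ν := ν) (t := t + 1) (q := q.length + r.length)
        ⟨w, by rwa [seen_succ_of_mem hold], q.append r, by simp⟩
      unfold excess
      omega
    · have := h.frontierDist_le_succ ht ⟨w, hw, r, le_rfl⟩
      omega

theorem exists_lost_edges (h : GreedyRun E H ν K) :
    ∃ y : ℕ → V, ∀ ℓ, ∀ t ∈ detourSteps E ν K ℓ, (trusted E ν t).Adj (ν (t + 1)) (y t) ∧
      (∀ p : (trusted E ν (t + 1)).Walk (ν (t + 1)) (y t), ℓ + 1 ≤ p.length) ∧
      ∀ t' ∈ detourSteps E ν K ℓ, t < t' → (trusted E ν (t + 1)).Adj (ν (t' + 1)) (y t') := by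
  have : ∀ t, ∃ y, t < K → ν (t + 1) ∈ seen ν t → (trusted E ν t).Adj (ν (t + 1)) y ∧
      ∀ p : (trusted E ν (t + 1)).Walk (ν (t + 1)) y, excess E ν t + 1 ≤ p.length := by
    intro t
    by_cases hh : t < K ∧ ν (t + 1) ∈ seen ν t
    · obtain ⟨y, hy⟩ := h.exists_lost_edge hh.1 hh.2
      exact ⟨y, fun _ _ => hy⟩
    · exact ⟨ν 0, fun h1 h2 => absurd ⟨h1, h2⟩ hh⟩
  choose y hy using this
  refine ⟨y, fun ℓ t ht => ?_⟩
  obtain ⟨htK, hold, hinc⟩ := mem_detourSteps.1 ht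
  obtain ⟨h1, h2⟩ := hy t htK hold
  refine ⟨h1, fun p => (Nat.succ_le_succ hinc).trans (h2 p), fun t' ht' hlt => ?_⟩
  obtain ⟨htK', hold', -⟩ := mem_detourSteps.1 ht'
  exact trusted_anti E ν hlt (hy t' htK' hold').1

/-- Lost edges are distinct, and they belong to `G` because one end had been visited while the edge
was trusted. -/
theorem card_detourSteps_le_edges (h : GreedyRun E H ν K) {G : SimpleGraph V}
    (hG : ∀ t, E t ≤ G) {ℓ : ℕ} (hℓ : 1 ≤ ℓ) :
    (detourSteps E ν K ℓ).card ≤ G.edgeSet.ncard := by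
  obtain ⟨y, hy⟩ := h.exists_lost_edges
  have key : ∀ t ∈ detourSteps E ν K ℓ, ∀ t' ∈ detourSteps E ν K ℓ, t < t' →
      s(ν (t + 1), y t) ≠ s(ν (t' + 1), y t') := by
    intro t ht t' ht' hlt heq
    obtain ⟨-, h2, h3⟩ := hy ℓ t ht
    have hadj : (trusted E ν (t + 1)).Adj (ν (t + 1)) (y t) := by
      rw [← SimpleGraph.mem_edgeSet, heq]
      exact h3 t' ht' hlt
    have := h2 hadj.toWalk
    simp at this
    omega
  rw [← Set.ncard_coe_finset]
  refine Set.ncard_le_ncard_of_injOn (fun t => s(ν (t + 1), y t)) (fun t ht => ?_)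
    (fun t ht t' ht' heq => ?_) (Set.toFinite _)
  · obtain ⟨i, hi, hi'⟩ := (mem_detourSteps.1 ht).2.1
    exact hG i ((hy ℓ t ht).1.2 i hi (.inl hi'))
  · rcases lt_trichotomy t t' with hlt | hlt | hlt
    · exact absurd heq (key t ht t' ht' hlt)
    · exact hlt
    · exact absurd heq.symm (key t' ht' t ht hlt)

theorem card_detourSteps_le_of_contraction (h : GreedyRun E H ν K) (γ : V → V) {k σ ℓ N : ℕ}
    (hk : 1 ≤ k) {ρ : ℝ} (hρ : 0 ≤ ρ) (hγ : (Set.range γ).ncard ≤ N) (hN : (N : ℝ) ≤ ρ ^ k)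
    (hcon : ∀ v, ∃ p : H.Walk v (γ v), p.length ≤ σ)
    (hkl : (2 * k + 2) * (2 * σ + 1) ≤ ℓ + 1) :
    ((detourSteps E ν K ℓ).card : ℝ) ≤ ρ * N := by
  obtain ⟨y, hy⟩ := h.exists_lost_edges
  refine card_le_of_contraction (detourSteps E ν K ℓ) (fun t => trusted E ν (t + 1))
    (fun t => ν (t + 1)) y γ hk hρ hγ hN (fun t ht v => ?_) (fun t ht => (hy ℓ t ht).2.2)
    (fun t ht => (hy ℓ t ht).2.1) hkl
  obtain ⟨p, hp⟩ := hcon v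
  have htK := (mem_detourSteps.1 ht).1
  exact ⟨p.mapLe (h.le_trusted htK), by simpa using hp⟩

theorem card_detourSteps_le_mul_card (h : GreedyRun E H ν K) {k ℓ : ℕ} (hk : 1 ≤ k) {ρ : ℝ}
    (hρ : 0 ≤ ρ) (hN : (Fintype.card V : ℝ) ≤ ρ ^ k) (hkl : 2 * k + 2 ≤ ℓ + 1) :
    ((detourSteps E ν K ℓ).card : ℝ) ≤ ρ * Fintype.card V := by
  refine h.card_detourSteps_le_of_contraction id (σ := 0) hk hρ ?_ hN
    (fun v => ⟨.nil, le_rfl⟩) (by simpa using hkl)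
  simp [Set.ncard_univ]

/-- Contract with σ ≈ ℓ / (8(k + 1)), so that (2k + 2)(2σ + 1) ≤ ℓ. At most 2n / (σ + 1) vertices
remain, and ρ = 2 is admissible because n ≤ 2 ^ k. -/
theorem card_detourSteps_mul_le (h : GreedyRun E H ν K) {k ℓ : ℕ} (hk : 1 ≤ k)
    (hN : Fintype.card V ≤ 2 ^ k) (hkl : 4 * (k + 1) ≤ ℓ) (hℓ : ℓ ≤ Fintype.card V) :
    (detourSteps E ν K ℓ).card * ℓ ≤ 32 * Fintype.card V * (k + 1) := by
  set σ := ℓ / (8 * (k + 1)) with hσ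
  have h1 : σ * (8 * (k + 1)) ≤ ℓ := Nat.div_mul_le_self _ _
  have h2 : ℓ ≤ 8 * (k + 1) * (σ + 1) := (Nat.lt_mul_div_succ ℓ (by omega)).le
  have h3 : σ + 1 ≤ Fintype.card V := by nlinarith
  obtain ⟨γ, hγ, hcon⟩ := exists_contraction h.conn h3
  have h4 : (Set.range γ).ncard ≤ 2 ^ k := by
    refine le_trans ?_ hN
    have := Set.ncard_le_ncard (Set.subset_univ (Set.range γ)) (Set.toFinite _)
    rwa [Set.ncard_univ, Nat.card_eq_fintype_card] at this
  have h5 := h.card_detourSteps_le_of_contraction γ (ℓ := ℓ) hk (ρ := 2) (by norm_num) le_rfl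
    (by exact_mod_cast h4) hcon (by nlinarith)
  have h6 : (detourSteps E ν K ℓ).card ≤ 2 * (Set.range γ).ncard := by exact_mod_cast h5
  calc (detourSteps E ν K ℓ).card * ℓ
      ≤ (2 * (Set.range γ).ncard) * (8 * (k + 1) * (σ + 1)) := Nat.mul_le_mul h6 h2
    _ = 16 * (k + 1) * ((Set.range γ).ncard * (σ + 1)) := by ring
    _ ≤ 16 * (k + 1) * (2 * Fintype.card V) := Nat.mul_le_mul_left _ hγ
    _ = _ := by ring

end GreedyRun

end Dynamics

/-! ### Summing the estimates over all levels. -/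

section Bound

theorem one_le_log_of_three_le {n : ℕ} (hn : 3 ≤ n) : 1 ≤ Real.log n := by
  have h3 : (3 : ℝ) ≤ n := by exact_mod_cast hn
  rw [Real.le_log_iff_exp_le (by linarith)]
  linarith [Real.exp_one_lt_d9]

theorem log_le_two_mul_log {n m : ℕ} (hn : 3 ≤ n) (hnm : n ≤ m) (hm : m ≤ n.choose 2) :
    Real.log m ≤ 2 * Real.log n := by
  have h1 : m ≤ n ^ 2 := hm.trans (Nat.choose_le_pow n 2)
  have h2 : (m : ℝ) ≤ (n : ℝ) ^ 2 := by exact_mod_cast h1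
  have h3 : (0 : ℝ) < m := by exact_mod_cast (by omega : 0 < m)
  calc Real.log m ≤ Real.log ((n : ℝ) ^ 2) := Real.log_le_log h3 h2
    _ = 2 * Real.log n := by rw [Real.log_pow]; norm_num

theorem half_le_eps {n m : ℕ} (hn : 3 ≤ n) (hnm : n ≤ m) (hm : m ≤ n.choose 2) :
    1 / 2 ≤ eps n m := by
  have h1 := one_le_log_of_three_le hn
  have h2 := log_le_two_mul_log hn hnm hm
  have h3 : Real.log n ≤ Real.log m :=
    Real.log_le_log (by exact_mod_cast (by omega : 0 < n)) (by exact_mod_cast hnm)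
  rw [eps, le_div_iff₀ (by linarith)]
  linarith

theorem one_le_logb_two {n : ℕ} (hn : 3 ≤ n) : 1 ≤ Real.logb 2 n := by
  have h3 : (3 : ℝ) ≤ n := by exact_mod_cast hn
  rw [Real.le_logb_iff_rpow_le (by norm_num) (by linarith)]
  norm_num
  linarith

/-- The quantity that bounds the exploration time up to a constant factor. -/
noncomputable def costBound (n m : ℕ) : ℝ := eps n m * m + n * Real.logb 2 n ^ 2

theorem one_le_costBound {n m : ℕ} (hn : 3 ≤ n) (hnm : n ≤ m) (hm : m ≤ n.choose 2) :
    1 ≤ costBound n m := by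
  have h1 := half_le_eps hn hnm hm
  have h2 : (3 : ℝ) ≤ m := by exact_mod_cast hn.trans hnm
  have h3 : 0 ≤ (n : ℝ) * Real.logb 2 n ^ 2 := by positivity
  rw [costBound]
  nlinarith

theorem sum_inv_le (n : ℕ) : ∑ ℓ ∈ Finset.Icc 1 n, (1 / (ℓ : ℝ)) ≤ 1 + Real.log n := by
  have := harmonic_le_one_add_log n
  rw [harmonic_eq_sum_Icc] at this
  push_cast at this
  simpa [one_div] using this

theorem sum_ite_lt_le (n : ℕ) {x y : ℝ} (hx : 0 ≤ x) (hy : 0 ≤ y) :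
    ∑ ℓ ∈ Finset.Icc 1 n, (if (ℓ : ℝ) < x then y else 0) ≤ x * y := by
  rw [← Finset.sum_filter, Finset.sum_const, nsmul_eq_mul]
  refine mul_le_mul_of_nonneg_right ?_ hy
  have hsub : {ℓ ∈ Finset.Icc 1 n | ((ℓ : ℕ) : ℝ) < x} ⊆ Finset.Icc 1 ⌊x⌋₊ := by
    intro ℓ hℓ
    rw [Finset.mem_filter, Finset.mem_Icc] at hℓ
    exact Finset.mem_Icc.2 ⟨hℓ.1.1, Nat.le_floor hℓ.2.le⟩
  have h1 := Finset.card_le_card hsub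
  rw [Nat.card_Icc, Nat.add_sub_cancel] at h1
  exact (Nat.cast_le.2 h1).trans (Nat.floor_le hx)

/-- For u = 1 + ln(m/n) one has n eᵘ = e m and u ≤ 2 exp(u/2), so n exp(u/2) u ≤ 2 e m; multiply by
ln n / u = ε. -/
theorem mul_exp_mul_log_le {n m : ℕ} (hn : 3 ≤ n) (hnm : n ≤ m) :
    n * Real.exp ((1 + Real.log m - Real.log n) / 2) * Real.log n ≤ 6 * (eps n m * m) := by
  set u := 1 + Real.log m - Real.log n with hu
  have hn0 : (0 : ℝ) < n := by exact_mod_cast (by omega : 0 < n)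
  have hm0 : (0 : ℝ) < m := by exact_mod_cast (by omega : 0 < m)
  have h3 : Real.log n ≤ Real.log m := Real.log_le_log hn0 (by exact_mod_cast hnm)
  have hu1 : 1 ≤ u := by rw [hu]; linarith
  have hL := one_le_log_of_three_le hn
  have hm' : n * Real.exp u = Real.exp 1 * m := by
    have : u = 1 + (Real.log m - Real.log n) := by rw [hu]; ring
    rw [this, Real.exp_add, Real.exp_sub, Real.exp_log hn0, Real.exp_log hm0]
    field_simp
  have h4 : u ≤ 2 * Real.exp (u / 2) := by linarith [Real.add_one_le_exp (u / 2)]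
  have h5 : Real.exp u = Real.exp (u / 2) * Real.exp (u / 2) := by
    rw [← Real.exp_add]; ring_nf
  have h6 : n * Real.exp (u / 2) * u ≤ 6 * m := by
    calc n * Real.exp (u / 2) * u ≤ n * Real.exp (u / 2) * (2 * Real.exp (u / 2)) :=
          mul_le_mul_of_nonneg_left h4 (by positivity)
      _ = 2 * (n * Real.exp u) := by rw [h5]; ring
      _ = 2 * Real.exp 1 * m := by rw [hm']; ring
      _ ≤ 6 * m := mul_le_mul_of_nonneg_right (by linarith [Real.exp_one_lt_d9]) hm0.le
  have h7 : eps n m = Real.log n / u := rfl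
  rw [h7, div_mul_eq_mul_div, mul_div_assoc', le_div_iff₀ (by linarith)]
  calc n * Real.exp (u / 2) * Real.log n * u = (n * Real.exp (u / 2) * u) * Real.log n := by ring
    _ ≤ 6 * m * Real.log n := mul_le_mul_of_nonneg_right h6 (by linarith)
    _ = _ := by ring

variable {V : Type*} [Fintype V] {E : ℕ → SimpleGraph V} {H : SimpleGraph V} {ν : ℕ → V} {K : ℕ}

/-- Each summand is the bound for one range of ℓ: counting edges for small ℓ, the plain Moore bound
in the middle, contraction for large ℓ. -/
theorem GreedyRun.card_detourSteps_le (h : GreedyRun E H ν K) {G : SimpleGraph V}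
    (hG : ∀ t, E t ≤ G) {n m : ℕ} (hV : Fintype.card V = n) (hE : G.edgeSet.ncard = m)
    (hn : 3 ≤ n) (hnm : n ≤ m) (hm : m ≤ n.choose 2) {ℓ : ℕ} (hℓ : ℓ ∈ Finset.Icc 1 n) :
    ((detourSteps E ν K ℓ).card : ℝ) ≤
      (if (ℓ : ℝ) < 8 * eps n m + 4 then (m : ℝ) else 0) +
      (if (ℓ : ℝ) < 4 * (Nat.clog 2 n + 1) then
        n * Real.exp ((1 + Real.log m - Real.log n) / 2) else 0) +
      32 * n * (Nat.clog 2 n + 1) * (1 / (ℓ : ℝ)) := by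
  obtain ⟨hℓ1, hℓn⟩ := Finset.mem_Icc.1 hℓ
  have hℓ0 : (0 : ℝ) < ℓ := by exact_mod_cast hℓ1
  have hn0 : (0 : ℝ) < n := by exact_mod_cast (by omega : 0 < n)
  have hε := half_le_eps hn hnm hm
  have hA : 0 ≤ (if (ℓ : ℝ) < 8 * eps n m + 4 then (m : ℝ) else 0) := by positivity
  have hB : 0 ≤ (if (ℓ : ℝ) < 4 * (Nat.clog 2 n + 1) then
      n * Real.exp ((1 + Real.log m - Real.log n) / 2) else 0) := by positivity
  have hC : 0 ≤ 32 * n * (Nat.clog 2 n + 1) * (1 / (ℓ : ℝ)) := by positivity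
  by_cases h1 : 4 * (Nat.clog 2 n + 1) ≤ ℓ
  · have hk : 1 ≤ Nat.clog 2 n := Nat.clog_pos (by norm_num) (by omega)
    have h2 := h.card_detourSteps_mul_le hk (hV.le.trans (Nat.le_pow_clog one_lt_two n)) h1
      (hV ▸ hℓn)
    rw [hV] at h2
    have h3 : ((detourSteps E ν K ℓ).card : ℝ) * ℓ ≤ 32 * n * (Nat.clog 2 n + 1) := by
      exact_mod_cast h2
    have h4 : ((detourSteps E ν K ℓ).card : ℝ) ≤ 32 * n * (Nat.clog 2 n + 1) * (1 / (ℓ : ℝ)) := by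
      rw [mul_one_div, le_div_iff₀ hℓ0]
      exact h3
    linarith
  by_cases h2 : (ℓ : ℝ) < 8 * eps n m + 4
  · have h3 := h.card_detourSteps_le_edges hG hℓ1
    rw [hE] at h3
    have h4 : ((detourSteps E ν K ℓ).card : ℝ) ≤ m := by exact_mod_cast h3
    rw [if_pos h2] at hA ⊢
    linarith
  · have h3 : (ℓ : ℝ) < 4 * (Nat.clog 2 n + 1) := by
      exact_mod_cast not_le.1 h1
    rw [if_pos h3] at hB ⊢
    have hu : 1 ≤ 1 + Real.log m - Real.log n := by
      linarith [Real.log_le_log hn0 (by exact_mod_cast hnm : (n : ℝ) ≤ m)]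
    have hεu : eps n m * (1 + Real.log m - Real.log n) = Real.log n := by
      rw [eps, div_mul_cancel₀ _ (by linarith)]
    push Not at h2
    have h4 : 4 ≤ ℓ := by
      have : (4 : ℝ) ≤ ℓ := by linarith
      exact_mod_cast this
    have h5 : (ℓ : ℝ) ≤ 2 * ((ℓ - 1) / 2 : ℕ) + 2 := by
      exact_mod_cast (by omega : ℓ ≤ 2 * ((ℓ - 1) / 2) + 2)
    -- With u = 1 + ln m - ln n and k = ⌊(ℓ - 1)/2⌋ ≥ 4ε + 1, the exponent k u / 2 is at least 2 ε u
    -- = 2 ln n, so ρ ^ k ≥ n.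
    have h6 := h.card_detourSteps_le_mul_card (ℓ := ℓ) (k := (ℓ - 1) / 2)
      (ρ := Real.exp ((1 + Real.log m - Real.log n) / 2)) (by omega) (Real.exp_pos _).le (by
        rw [← Real.exp_nat_mul, hV]
        nth_rewrite 1 [← Real.exp_log hn0]
        rw [Real.exp_le_exp]
        nlinarith) (by omega)
    rw [hV] at h6
    linarith

theorem GreedyRun.card_visitSteps_le (h : GreedyRun E H ν K) {n : ℕ} (hV : Fintype.card V = n)
    {ℓ : ℕ} (hℓ : ℓ ∈ Finset.Icc 1 n) :
    ((visitSteps E ν K ℓ).card : ℝ) ≤ 2 * n * (1 / (ℓ : ℝ)) := by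
  obtain ⟨hℓ1, hℓn⟩ := Finset.mem_Icc.1 hℓ
  have h1 := h.card_visitSteps_mul_le hℓ1 (hV ▸ hℓn)
  rw [hV] at h1
  rw [mul_one_div, le_div_iff₀ (by exact_mod_cast hℓ1)]
  exact_mod_cast h1

/-- The length of a greedy run that has not visited all nodes. -/
theorem GreedyRun.length_le (h : GreedyRun E H ν K) {G : SimpleGraph V}
    (hG : ∀ t, E t ≤ G) {n m : ℕ} (hV : Fintype.card V = n) (hE : G.edgeSet.ncard = m)
    (hn : 3 ≤ n) (hnm : n ≤ m) (hm : m ≤ n.choose 2) : (K : ℝ) ≤ 200 * costBound n m := by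
  set k : ℕ := Nat.clog 2 n with hk
  set x : ℝ := n * Real.exp ((1 + Real.log m - Real.log n) / 2) with hx
  have hx0 : 0 ≤ x := by positivity
  have hε := half_le_eps hn hnm hm
  have hL := one_le_log_of_three_le hn
  have hlg := one_le_logb_two hn
  have hn0 : (0 : ℝ) < n := by exact_mod_cast (by omega : 0 < n)
  have h1 : (K : ℝ) ≤ n + ∑ ℓ ∈ Finset.Icc 1 n,
      (((visitSteps E ν K ℓ).card : ℝ) + (detourSteps E ν K ℓ).card) := by
    have := h.le_sum_card
    rw [hV] at this
    exact_mod_cast this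
  have h2 : ∑ ℓ ∈ Finset.Icc 1 n,
      (((visitSteps E ν K ℓ).card : ℝ) + (detourSteps E ν K ℓ).card) ≤
      ∑ ℓ ∈ Finset.Icc 1 n, (2 * n * (1 / (ℓ : ℝ)) +
        ((if (ℓ : ℝ) < 8 * eps n m + 4 then (m : ℝ) else 0) +
          (if (ℓ : ℝ) < 4 * (k + 1) then x else 0) + 32 * n * (k + 1) * (1 / (ℓ : ℝ)))) :=
    Finset.sum_le_sum fun ℓ hℓ => add_le_add (h.card_visitSteps_le hV hℓ)
      (h.card_detourSteps_le hG hV hE hn hnm hm hℓ)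
  simp only [Finset.sum_add_distrib, ← Finset.mul_sum] at h1 h2
  have h3 := sum_inv_le n
  have h4 := sum_ite_lt_le n (x := 8 * eps n m + 4) (y := m) (by linarith) (by positivity)
  have h5 := sum_ite_lt_le n (x := 4 * ((k : ℝ) + 1)) (y := x) (by positivity) hx0
  have hkl : (k : ℝ) ≤ Real.logb 2 n + 1 := by
    have := Real.natCeil_logb_natCast 2 n
    rw [hk, ← this]
    push_cast
    exact (Nat.ceil_lt_add_one (by linarith)).le
  have hlog2 := Real.log_two_gt_d9
  have hlog2' := Real.log_two_lt_d9
  have hlogb : Real.logb 2 n * Real.log 2 = Real.log n :=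
    div_mul_cancel₀ _ (by linarith)
  have h6 : Real.log n ≤ Real.logb 2 n := by nlinarith
  have h7 : Real.logb 2 n ≤ 2 * Real.log n := by nlinarith
  have h8 := mul_exp_mul_log_le hn hnm
  rw [← hx] at h8
  rw [costBound]
  generalize Real.logb 2 n = g at *
  generalize Real.log n = L at *
  -- The coefficients add up to 1 + 4 + 192 for n log² n and 144 + 16 for ε m, both below 200.
  have b1 : (n : ℝ) ≤ n * g ^ 2 := le_mul_of_one_le_right hn0.le (one_le_pow₀ hlg)
  have b2 : 2 * (n : ℝ) * ∑ ℓ ∈ Finset.Icc 1 n, (1 / (ℓ : ℝ)) ≤ 4 * (n * g ^ 2) := by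
    calc _ ≤ 2 * (n : ℝ) * (2 * g ^ 2) :=
          mul_le_mul_of_nonneg_left (by nlinarith) (by positivity)
      _ = _ := by ring
  have b3 : 32 * (n : ℝ) * (k + 1) * ∑ ℓ ∈ Finset.Icc 1 n, (1 / (ℓ : ℝ)) ≤ 192 * (n * g ^ 2) := by
    have hs : ∑ ℓ ∈ Finset.Icc 1 n, (1 / (ℓ : ℝ)) ≤ 2 * g := by linarith
    have hk3 : (k : ℝ) + 1 ≤ 3 * g := by linarith
    calc _ ≤ 32 * (n : ℝ) * (3 * g) * (2 * g) := by
          apply mul_le_mul (mul_le_mul_of_nonneg_left hk3 (by positivity)) hs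
          · positivity
          · positivity
      _ = _ := by ring
  have b4 : 4 * ((k : ℝ) + 1) * x ≤ 144 * (eps n m * m) := by
    have hk3 : (k : ℝ) + 1 ≤ 6 * L := by linarith
    calc _ ≤ 4 * (6 * L) * x := by gcongr
      _ = 24 * (x * L) := by ring
      _ ≤ 24 * (6 * (eps n m * m)) := by gcongr
      _ = _ := by ring
  have b5 : (8 * eps n m + 4) * m ≤ 16 * (eps n m * m) := by
    have : (0 : ℝ) ≤ m := by positivity
    nlinarith
  have b6 : 0 ≤ eps n m * m := by positivity
  have b7 : 0 ≤ (n : ℝ) * g ^ 2 := by positivity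
  linarith

end Bound

/-! ### Existence of an implementation. -/

section Existence

theorem LearnedPort.of_mapGraph_adj {h : List Observation} {u v : ℕ} (hu : u ∈ visited h)
    (huv : (mapGraph h).Adj u v) : ∃ p, LearnedPort h u v p := by
  rw [mapGraph, SimpleGraph.fromRel_adj] at huv
  rcases huv.2 with (⟨-, -, ⟨p, hp, -⟩, -⟩ | ⟨-, -, p, hp, -⟩) |
    (⟨-, -, -, p, hp, -⟩ | ⟨-, hu', -⟩)
  · exact ⟨p, hp⟩
  · exact ⟨p, hp⟩
  · exact ⟨p, hp⟩
  · exact absurd hu hu'.2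

theorem exists_isGreedyExp₁ : ∃ A : Algorithm, IsGreedyExp₁ A := by
  have key : ∀ h : List Observation, ∃ a : Option ℕ, ∀ o : Observation, h.getLast? = some o →
      (mapped h \ visited h = ∅ → a = none) ∧
      ((∃ w ∈ mapped h \ visited h, (mapGraph h).Reachable o.node w) →
        ∃ w ∈ mapped h \ visited h, ∃ P : (mapGraph h).Walk o.node w,
          (∀ w' ∈ mapped h \ visited h, ∀ Q : (mapGraph h).Walk o.node w',
            P.length ≤ Q.length) ∧
          ∃ p, LearnedPort h o.node P.snd p ∧ a = some p) := by
    intro h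
    by_cases hr : ∃ o, h.getLast? = some o ∧
        ∃ w ∈ mapped h \ visited h, (mapGraph h).Reachable o.node w
    · obtain ⟨o, ho, w₀, hw₀, ⟨P₀⟩⟩ := hr
      let S : Set ℕ := {q | ∃ w ∈ mapped h \ visited h, ∃ P : (mapGraph h).Walk o.node w,
        P.length = q}
      obtain ⟨w, hw, P, hP⟩ : sInf S ∈ S := Nat.sInf_mem ⟨_, w₀, hw₀, P₀, rfl⟩
      have hvis : o.node ∈ visited h := ⟨o, List.mem_of_getLast? ho, rfl⟩
      have hnil : ¬ P.Nil := fun hn => hw.2 (hn.eq ▸ hvis)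
      obtain ⟨p, hp⟩ := LearnedPort.of_mapGraph_adj hvis (P.adj_snd hnil)
      refine ⟨some p, fun o' ho' => ?_⟩
      obtain rfl : o = o' := by simpa using ho.symm.trans ho'
      refine ⟨fun he => absurd hw (by simp [he]), fun _ => ⟨w, hw, P, ?_, p, hp, rfl⟩⟩
      intro w' hw' Q
      rw [hP]
      exact Nat.sInf_le ⟨w', hw', Q, rfl⟩
    -- Terminating satisfies the first clause, and the second is vacuous when no target is
    -- reachable.
    · exact ⟨none, fun o ho => ⟨fun _ => rfl, fun hh => absurd ⟨o, ho, hh⟩ hr⟩⟩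
  choose A hA using key
  exact ⟨A, hA⟩

end Existence

/-! ### The agent's map compared with the trusted graph. -/

section Map

variable {V : Type*} [Fintype V] (𝒢 : DynGraph V) (ν : ℕ → V) (t : ℕ)

theorem mem_history {o : Observation} : o ∈ 𝒢.history ν t ↔ ∃ i ≤ t, 𝒢.obs ν i = o := by
  simp [DynGraph.history]

theorem getLast?_history : (𝒢.history ν t).getLast? = some (𝒢.obs ν t) := by
  simp [DynGraph.history, List.getLast?_range]

theorem mem_obs_nbrs {i a p : ℕ} : (a, p) ∈ (𝒢.obs ν i).nbrs ↔
    ∃ v, (𝒢.E i).Adj (ν i) v ∧ 𝒢.id v = a ∧ 𝒢.port (ν i) v = p := by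
  simp [DynGraph.obs]

theorem mem_obs_ports {i p : ℕ} : p ∈ (𝒢.obs ν i).ports ↔
    ∃ v, (𝒢.E i).Adj (ν i) v ∧ 𝒢.port (ν i) v = p := by
  simp [DynGraph.obs]

variable {𝒢 ν t}

theorem id_mem_visited {v : V} : 𝒢.id v ∈ visited (𝒢.history ν t) ↔ v ∈ seen ν t := by
  constructor
  · rintro ⟨o, ho, hv⟩
    obtain ⟨i, hi, rfl⟩ := (mem_history 𝒢 ν t).1 ho
    exact ⟨i, hi, 𝒢.id_injective hv⟩
  · rintro ⟨i, hi, rfl⟩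
    exact ⟨_, (mem_history 𝒢 ν t).2 ⟨i, hi, rfl⟩, rfl⟩

theorem exists_id_of_mem_mapped {a : ℕ} (ha : a ∈ mapped (𝒢.history ν t)) :
    ∃ v, 𝒢.id v = a := by
  rcases ha with ⟨o, ho, rfl⟩ | ⟨o, ho, p, hp⟩
  · obtain ⟨i, -, rfl⟩ := (mem_history 𝒢 ν t).1 ho
    exact ⟨ν i, rfl⟩
  · obtain ⟨i, -, rfl⟩ := (mem_history 𝒢 ν t).1 ho
    obtain ⟨v, -, hv, -⟩ := (mem_obs_nbrs 𝒢 ν).1 hp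
    exact ⟨v, hv⟩

theorem id_mem_mapped_of_adj {i : ℕ} (hi : i ≤ t) {v : V} (h : (𝒢.E i).Adj (ν i) v) :
    𝒢.id v ∈ mapped (𝒢.history ν t) :=
  .inr ⟨_, (mem_history 𝒢 ν t).2 ⟨i, hi, rfl⟩, 𝒢.port (ν i) v,
    (mem_obs_nbrs 𝒢 ν).2 ⟨v, h, rfl, rfl⟩⟩

theorem learnedPort_of_adj {i : ℕ} (hi : i ≤ t) {v : V} (h : (𝒢.E i).Adj (ν i) v) :
    LearnedPort (𝒢.history ν t) (𝒢.id (ν i)) (𝒢.id v) (𝒢.port (ν i) v) :=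
  .inl ⟨_, (mem_history 𝒢 ν t).2 ⟨i, hi, rfl⟩, rfl, (mem_obs_nbrs 𝒢 ν).2 ⟨v, h, rfl, rfl⟩⟩

theorem history_getElem? {i : ℕ} {o : Observation} (h : (𝒢.history ν t)[i]? = some o) :
    i ≤ t ∧ 𝒢.obs ν i = o := by
  rw [DynGraph.history, List.getElem?_map, Option.map_eq_some_iff] at h
  obtain ⟨j, hj, rfl⟩ := h
  obtain ⟨hi, hj⟩ := List.getElem?_eq_some_iff.1 hj
  rw [List.getElem_range] at hj
  rw [List.length_range] at hi
  exact ⟨by omega, by rw [hj]⟩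

/-- Learned port numbers are the actual ones. -/
theorem LearnedPort.eq_port (hrun : ∀ i < t, (𝒢.E i).Adj (ν i) (ν (i + 1))) {u v : V} {p : ℕ}
    (h : LearnedPort (𝒢.history ν t) (𝒢.id u) (𝒢.id v) p) :
    𝒢.G.Adj u v ∧ p = 𝒢.port u v := by
  rcases h with ⟨o, ho, hu, hv⟩ | ⟨i, o, o', ho, ho', hv, hu, hp⟩
  · obtain ⟨i, -, rfl⟩ := (mem_history 𝒢 ν t).1 ho
    obtain ⟨v', hadj, hv', rfl⟩ := (mem_obs_nbrs 𝒢 ν).1 hv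
    obtain rfl := 𝒢.id_injective hu
    obtain rfl := 𝒢.id_injective hv'
    exact ⟨𝒢.E_le i hadj, rfl⟩
  · obtain ⟨-, rfl⟩ := history_getElem? ho
    obtain ⟨hi, rfl⟩ := history_getElem? ho'
    obtain rfl := 𝒢.id_injective hu
    obtain rfl := 𝒢.id_injective hv
    refine ⟨(𝒢.E_le i (hrun i (by omega))).symm, ?_⟩
    simpa [DynGraph.obs] using hp.symm

theorem port_mem_deleted {u v : V} (huv : 𝒢.G.Adj u v) :
    𝒢.port u v ∈ deleted (𝒢.history ν t) (𝒢.id u) ↔ ∃ i ≤ t, ν i = u ∧ ¬ (𝒢.E i).Adj u v := by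
  constructor
  · rintro ⟨o, ho, hu, -, hp⟩
    obtain ⟨i, hi, rfl⟩ := (mem_history 𝒢 ν t).1 ho
    obtain rfl := 𝒢.id_injective hu
    exact ⟨i, hi, rfl, fun h => hp ((mem_obs_ports 𝒢 ν).2 ⟨v, h, rfl⟩)⟩
  · rintro ⟨i, hi, rfl, hadj⟩
    refine ⟨_, (mem_history 𝒢 ν t).2 ⟨i, hi, rfl⟩, rfl, (𝒢.port_bijOn (ν i)).mapsTo huv, ?_⟩
    intro hp
    obtain ⟨w, hw, hwp⟩ := (mem_obs_ports 𝒢 ν).1 hp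
    obtain rfl := (𝒢.port_bijOn (ν i)).injOn (𝒢.E_le i hw) huv hwp
    exact hadj hw

/-- At any visit of `u` the agent sees its present neighbours with their ports. Injectivity of the
port numbering identifies a missing port with a missing edge. -/
theorem usable_iff (hrun : ∀ i < t, (𝒢.E i).Adj (ν i) (ν (i + 1))) {u v : V}
    (hu : u ∈ seen ν t) :
    Usable (𝒢.history ν t) (𝒢.id u) (𝒢.id v) ↔ ∀ i ≤ t, ν i = u → (𝒢.E i).Adj u v := by
  constructor
  · rintro ⟨p, hp, hdel⟩ i hi hiu
    obtain ⟨hadj, rfl⟩ := hp.eq_port hrun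
    by_contra hcon
    exact hdel ((port_mem_deleted hadj).2 ⟨i, hi, hiu, hcon⟩)
  · intro h
    obtain ⟨i, hi, rfl⟩ := hu
    have hadj := h i hi rfl
    refine ⟨_, learnedPort_of_adj hi hadj, fun hdel => ?_⟩
    obtain ⟨j, hj, hji, hcon⟩ := (port_mem_deleted (𝒢.E_le i hadj)).1 hdel
    exact hcon (h j hj hji)

theorem mapGraph_adj_id (hrun : ∀ i < t, (𝒢.E i).Adj (ν i) (ν (i + 1))) {u v : V} :
    (mapGraph (𝒢.history ν t)).Adj (𝒢.id u) (𝒢.id v) ↔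
      (trusted 𝒢.E ν t).Adj u v ∧ (u ∈ seen ν t ∨ v ∈ seen ν t) := by
  have hto : ∀ u v, u ≠ v →
      ((𝒢.id u ∈ visited (𝒢.history ν t) ∧ 𝒢.id v ∈ visited (𝒢.history ν t) ∧
        Usable (𝒢.history ν t) (𝒢.id u) (𝒢.id v) ∧ Usable (𝒢.history ν t) (𝒢.id v) (𝒢.id u)) ∨
      (𝒢.id u ∈ visited (𝒢.history ν t) ∧
        𝒢.id v ∈ mapped (𝒢.history ν t) \ visited (𝒢.history ν t) ∧
        Usable (𝒢.history ν t) (𝒢.id u) (𝒢.id v))) →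
      (trusted 𝒢.E ν t).Adj u v ∧ u ∈ seen ν t := by
    intro u v hne h
    rcases h with ⟨hu, hv, h1, h2⟩ | ⟨hu, hv, h1⟩
    · rw [id_mem_visited] at hu hv
      rw [usable_iff hrun hu] at h1
      rw [usable_iff hrun hv] at h2
      exact ⟨⟨hne, fun i hi hh => hh.elim (h1 i hi) fun hh => (h2 i hi hh).symm⟩, hu⟩
    · rw [id_mem_visited] at hu
      have hv' : v ∉ seen ν t := fun hh => hv.2 (id_mem_visited.2 hh)
      rw [usable_iff hrun hu] at h1
      exact ⟨⟨hne, fun i hi hh => hh.elim (h1 i hi) fun hh => absurd ⟨i, hi, hh⟩ hv'⟩, hu⟩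
  have hfrom : ∀ u v, (trusted 𝒢.E ν t).Adj u v → u ∈ seen ν t →
      ((𝒢.id u ∈ visited (𝒢.history ν t) ∧ 𝒢.id v ∈ visited (𝒢.history ν t) ∧
        Usable (𝒢.history ν t) (𝒢.id u) (𝒢.id v) ∧ Usable (𝒢.history ν t) (𝒢.id v) (𝒢.id u)) ∨
      (𝒢.id u ∈ visited (𝒢.history ν t) ∧
        𝒢.id v ∈ mapped (𝒢.history ν t) \ visited (𝒢.history ν t) ∧
        Usable (𝒢.history ν t) (𝒢.id u) (𝒢.id v))) := by
    intro u v h hu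
    have h1 : Usable (𝒢.history ν t) (𝒢.id u) (𝒢.id v) :=
      (usable_iff hrun hu).2 fun i hi hiu => h.2 i hi (.inl hiu)
    by_cases hv : v ∈ seen ν t
    · exact .inl ⟨id_mem_visited.2 hu, id_mem_visited.2 hv, h1,
        (usable_iff hrun hv).2 fun i hi hiv => (h.2 i hi (.inr hiv)).symm⟩
    · refine .inr ⟨id_mem_visited.2 hu, ⟨?_, fun hh => hv (id_mem_visited.1 hh)⟩, h1⟩
      obtain ⟨i, hi, rfl⟩ := hu
      exact id_mem_mapped_of_adj hi (h.2 i hi (.inl rfl))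
  rw [mapGraph, SimpleGraph.fromRel_adj]
  constructor
  · rintro ⟨hne, h | h⟩
    · have := hto u v (fun hh => hne (hh ▸ rfl)) h
      exact ⟨this.1, .inl this.2⟩
    · have := hto v u (fun hh => hne (hh ▸ rfl)) h
      exact ⟨this.1.symm, .inr this.2⟩
  · rintro ⟨h, hu | hv⟩
    · exact ⟨fun hh => h.1 (𝒢.id_injective hh), .inl (hfrom u v h hu)⟩
    · exact ⟨fun hh => h.1 (𝒢.id_injective hh), .inr (hfrom v u h.symm hv)⟩

theorem exists_id_of_mapGraph_adj {a b : ℕ} (h : (mapGraph (𝒢.history ν t)).Adj a b) :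
    ∃ v, 𝒢.id v = b := by
  rw [mapGraph, SimpleGraph.fromRel_adj] at h
  apply exists_id_of_mem_mapped (ν := ν) (t := t)
  rcases h.2 with (⟨-, h, -⟩ | ⟨-, h, -⟩) | (⟨h, -⟩ | ⟨h, -⟩)
  exacts [.inl h, h.1, .inl h, .inl h]

theorem exists_trusted_walk (hrun : ∀ i < t, (𝒢.E i).Adj (ν i) (ν (i + 1))) {a b : ℕ}
    (P : (mapGraph (𝒢.history ν t)).Walk a b) (u : V) (hu : 𝒢.id u = a) :
    ∃ v, 𝒢.id v = b ∧ ∃ q : (trusted 𝒢.E ν t).Walk u v, q.length = P.length := by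
  induction P generalizing u with
  | nil => exact ⟨u, hu, .nil, rfl⟩
  | cons h P ih =>
    subst hu
    obtain ⟨w, rfl⟩ := exists_id_of_mapGraph_adj h
    obtain ⟨v, hv, q, hq⟩ := ih w rfl
    exact ⟨v, hv, .cons ((mapGraph_adj_id hrun).1 h).1 q, by simp [hq]⟩

/-- Cut the walk at its first unvisited node; until then each edge starts at a visited node and so
appears in the map. -/
theorem exists_mapGraph_walk (hrun : ∀ i < t, (𝒢.E i).Adj (ν i) (ν (i + 1))) {u w : V}
    (p : (trusted 𝒢.E ν t).Walk u w) (hu : u ∈ seen ν t) (hw : w ∉ seen ν t) :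
    ∃ a ∈ mapped (𝒢.history ν t) \ visited (𝒢.history ν t),
      ∃ Q : (mapGraph (𝒢.history ν t)).Walk (𝒢.id u) a, Q.length ≤ p.length := by
  induction p with
  | nil => exact absurd hu hw
  | @cons u b w h p ih =>
    have hadj := (mapGraph_adj_id hrun).2 ⟨h, .inl hu⟩
    by_cases hb : b ∈ seen ν t
    · obtain ⟨a, ha, Q, hQ⟩ := ih hb hw
      exact ⟨a, ha, .cons hadj Q, by simpa using hQ⟩
    · refine ⟨𝒢.id b, ⟨?_, fun hh => hb (id_mem_visited.1 hh)⟩, hadj.toWalk, by simp⟩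
      obtain ⟨i, hi, rfl⟩ := hu
      exact id_mem_mapped_of_adj hi (h.2 i hi (.inl rfl))

theorem IsGreedyExp₁.eq_none {A : Algorithm} (hA : IsGreedyExp₁ A)
    (hall : ∀ v, v ∈ seen ν t) : A (𝒢.history ν t) = none := by
  refine (hA _ _ (getLast?_history 𝒢 ν t)).1 (Set.sdiff_eq_empty.2 fun a ha => ?_)
  obtain ⟨v, rfl⟩ := exists_id_of_mem_mapped ha
  exact id_mem_visited.2 (hall v)

/-- As long as there are unvisited nodes, the agent follows a shortest trusted path. -/
theorem IsGreedyExp₁.exists_step {A : Algorithm} (hA : IsGreedyExp₁ A)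
    (hrun : ∀ i < t, (𝒢.E i).Adj (ν i) (ν (i + 1))) (hnear : ∃ q, Near 𝒢.E ν t (ν t) q) :
    ∃ v, (trusted 𝒢.E ν t).Adj (ν t) v ∧ A (𝒢.history ν t) = some (𝒢.port (ν t) v) ∧
      ∃ q, Near 𝒢.E ν t v q ∧ ∀ q', Near 𝒢.E ν t (ν t) q' → q + 1 ≤ q' := by
  obtain ⟨q₀, w₀, hw₀, p₀, -⟩ := hnear
  obtain ⟨a₀, ha₀, Q₀, -⟩ := exists_mapGraph_walk hrun p₀ (mem_seen ν t) hw₀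
  obtain ⟨w, hw, P, hmin, p, hp, hAp⟩ :=
    (hA _ _ (getLast?_history 𝒢 ν t)).2 ⟨a₀, ha₀, ⟨Q₀⟩⟩
  change (mapGraph (𝒢.history ν t)).Walk (𝒢.id (ν t)) w at P
  change LearnedPort _ (𝒢.id (ν t)) P.snd p at hp
  cases P with
  | nil => exact absurd (id_mem_visited.2 (mem_seen ν t)) hw.2
  | @cons _ b _ hadj P =>
    rw [SimpleGraph.Walk.snd_cons] at hp
    obtain ⟨v, rfl⟩ := exists_id_of_mapGraph_adj hadj
    have htr := ((mapGraph_adj_id hrun).1 hadj).1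
    obtain ⟨-, rfl⟩ := hp.eq_port hrun
    refine ⟨v, htr, hAp, P.length, ?_, ?_⟩
    · obtain ⟨z, rfl, q, hq⟩ := exists_trusted_walk hrun P v rfl
      exact ⟨z, fun hh => hw.2 (id_mem_visited.2 hh), q, hq.le⟩
    · rintro q' ⟨z, hz, r, hr⟩
      obtain ⟨a, ha, Q, hQ⟩ := exists_mapGraph_walk hrun r (mem_seen ν t) hz
      have : P.length + 1 ≤ Q.length := hmin a ha Q
      omega

end Map

/-! ### Building the trajectory step by step. -/

section Trajectory

variable {V : Type*}

theorem seen_congr {ν ν' : ℕ → V} {t : ℕ} (h : ∀ i ≤ t, ν i = ν' i) : seen ν t = seen ν' t := by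
  ext v
  exact exists_congr fun i => and_congr_right fun hi => by rw [h i hi]

theorem trusted_congr (E : ℕ → SimpleGraph V) {ν ν' : ℕ → V} {t : ℕ} (h : ∀ i ≤ t, ν i = ν' i) :
    trusted E ν t = trusted E ν' t := by
  ext u v
  exact and_congr_right fun _ => forall_congr' fun i => forall_congr' fun hi => by rw [h i hi]

theorem near_congr (E : ℕ → SimpleGraph V) {ν ν' : ℕ → V} {t : ℕ} (h : ∀ i ≤ t, ν i = ν' i) :
    Near E ν t = Near E ν' t := by
  funext a q
  rw [Near, Near, seen_congr h, trusted_congr E h]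

variable [Fintype V]

theorem history_congr (𝒢 : DynGraph V) {ν ν' : ℕ → V} {t : ℕ} (h : ∀ i ≤ t, ν i = ν' i) :
    𝒢.history ν t = 𝒢.history ν' t := by
  refine List.map_congr_left fun i hi => ?_
  have hi : i ≤ t := Nat.lt_succ_iff.1 (List.mem_range.1 hi)
  have h1 := h i hi
  have h2 := h (i - 1) (by omega)
  unfold DynGraph.obs
  rw [h1, h2]

/-- `ν 0, …, ν k` is the beginning of a run of `A` from `s` along shortest trusted paths. -/
def IsGreedyPrefix (A : Algorithm) (𝒢 : DynGraph V) (s : V) (ν : ℕ → V) (k : ℕ) : Prop :=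
  ν 0 = s ∧ ∀ t < k, (trusted 𝒢.E ν t).Adj (ν t) (ν (t + 1)) ∧
    A (𝒢.history ν t) = some (𝒢.port (ν t) (ν (t + 1))) ∧
    ∃ q, Near 𝒢.E ν t (ν (t + 1)) q ∧ ∀ q', Near 𝒢.E ν t (ν t) q' → q + 1 ≤ q'

namespace IsGreedyPrefix

variable {A : Algorithm} {𝒢 : DynGraph V} {s : V} {ν : ℕ → V} {k : ℕ}

theorem adj (h : IsGreedyPrefix A 𝒢 s ν k) : ∀ t < k, (𝒢.E t).Adj (ν t) (ν (t + 1)) :=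
  fun t ht => (h.2 t ht).1.2 t le_rfl (.inl rfl)

theorem greedyRun (h : IsGreedyPrefix A 𝒢 s ν k) {H : SimpleGraph V} (hH : H.Connected)
    (hle : ∀ t ≤ k, H ≤ 𝒢.E t) (hun : ∃ w, w ∉ seen ν k) : GreedyRun 𝒢.E H ν k where
  conn := hH
  le := hle
  unseen := hun
  adj t ht := (h.2 t ht).1
  greedy t ht := (h.2 t ht).2.2

theorem exists_succ (hA : IsGreedyExp₁ A) (h : IsGreedyPrefix A 𝒢 s ν k) {H : SimpleGraph V}
    (hH : H.Connected) (hle : ∀ t ≤ k, H ≤ 𝒢.E t) (hun : ∃ w, w ∉ seen ν k) :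
    ∃ ν', IsGreedyPrefix A 𝒢 s ν' (k + 1) := by
  obtain ⟨v, h1, h2, h3⟩ := hA.exists_step h.adj
    ⟨_, (h.greedyRun hH hle hun).near_frontierDist le_rfl⟩
  have hagree : ∀ t ≤ k, ∀ i ≤ t, (if i ≤ k then ν i else v) = ν i :=
    fun t ht i hi => if_pos (hi.trans ht)
  -- Only the value at k + 1 matters; histories, trust and nearness at times up to k depend on the
  -- unchanged part of the trajectory.
  refine ⟨fun i => if i ≤ k then ν i else v, by simpa using h.1, fun t ht => ?_⟩
  have htk : t ≤ k := by omega
  rw [trusted_congr 𝒢.E (hagree t htk), history_congr 𝒢 (hagree t htk),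
    near_congr 𝒢.E (hagree t htk)]
  beta_reduce
  rw [if_pos htk]
  rcases htk.lt_or_eq with hlt | rfl
  · rw [if_pos (by omega)]
    exact h.2 t hlt
  · rw [if_neg (by omega)]
    exact ⟨h1, h2, h3⟩

theorem exploresWithin (hA : IsGreedyExp₁ A) (h : IsGreedyPrefix A 𝒢 s ν k)
    (hall : ∀ v, v ∈ seen ν k) {τ : ℕ} (hk : k ≤ τ) : ExploresWithin A 𝒢 s τ :=
  ⟨ν, k, hk, ⟨h.1, fun t ht => ⟨h.adj t ht, (h.2 t ht).2.1⟩, hA.eq_none hall⟩, hall⟩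

end IsGreedyPrefix

/-- Extend a greedy prefix one step at a time. Either all nodes have been visited at some time up to
`K`, when the agent stops, or the prefix reaches length `K` with a node unvisited. -/
theorem exploresWithin_or_exists_greedyRun {A : Algorithm} (hA : IsGreedyExp₁ A)
    (𝒢 : DynGraph V) (s : V) {H : SimpleGraph V} (hH : H.Connected) {K : ℕ}
    (hle : ∀ t ≤ K, H ≤ 𝒢.E t) :
    ExploresWithin A 𝒢 s K ∨ ∃ ν, GreedyRun 𝒢.E H ν K := by
  by_contra! hcon
  have key : ∀ k ≤ K, ∃ ν, IsGreedyPrefix A 𝒢 s ν k := by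
    intro k
    induction k with
    | zero => exact fun _ => ⟨fun _ => s, rfl, fun t ht => absurd ht (by omega)⟩
    | succ k ih =>
      intro hk
      obtain ⟨ν, hν⟩ := ih (by omega)
      refine hν.exists_succ hA hH (fun t ht => hle t (by omega)) ?_
      by_contra! hall
      exact hcon.1 (hν.exploresWithin hA hall (by omega))
  obtain ⟨ν, hν⟩ := key K le_rfl
  refine hcon.2 ν (hν.greedyRun hH hle ?_)
  by_contra! hall
  exact hcon.1 (hν.exploresWithin hA hall le_rfl)

end Trajectory

end DynExp

theorem theorem2 :
    ∃ τ : ℕ → ℕ → ℕ,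
      (∃ C : ℝ, ∀ n m : ℕ, 3 ≤ n → n ≤ m → m ≤ n.choose 2 →
        1 ≤ τ n m ∧ (τ n m : ℝ) ≤ C * (DynExp.eps n m * m + n * Real.logb 2 n ^ 2)) ∧
      (∃ A : DynExp.Algorithm, DynExp.IsGreedyExp₁ A) ∧
      ∀ A : DynExp.Algorithm, DynExp.IsGreedyExp₁ A →
        ∀ n m : ℕ, 3 ≤ n → n ≤ m → m ≤ n.choose 2 →
          ∀ (V : Type*) [Fintype V] (𝒢 : DynExp.DynGraph V),
            Fintype.card V = n → 𝒢.G.edgeSet.ncard = m → 𝒢.IntervalConnected (τ n m) →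
              ∀ s : V, DynExp.ExploresWithin A 𝒢 s (τ n m) := by
  refine ⟨fun n m => ⌊1000 * DynExp.costBound n m⌋₊, ⟨1000, fun n m hn hnm hm => ?_⟩,
    DynExp.exists_isGreedyExp₁, fun A hA n m hn hnm hm V _ 𝒢 hV hE hconn s => ?_⟩
  · have h1 := DynExp.one_le_costBound hn hnm hm
    exact ⟨Nat.le_floor (by push_cast; linarith), Nat.floor_le (by linarith)⟩
  · have h1 := DynExp.one_le_costBound hn hnm hm
    simp only at hconn ⊢
    have hlt := Nat.lt_floor_add_one (1000 * DynExp.costBound n m)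
    have hpos : 1 ≤ ⌊1000 * DynExp.costBound n m⌋₊ := Nat.le_floor (by push_cast; linarith)
    generalize ⌊1000 * DynExp.costBound n m⌋₊ = τ at *
    -- Only the window starting at time 0 is needed. It covers the times 0, …, τ - 1, hence runs
    -- with τ - 1 steps.
    have hle : ∀ t ≤ τ - 1, (⨅ i ∈ Set.Ico 0 (0 + τ), 𝒢.E i) ≤ 𝒢.E t :=
      fun t ht => iInf₂_le t ⟨Nat.zero_le t, by omega⟩
    rcases DynExp.exploresWithin_or_exists_greedyRun hA 𝒢 s (hconn 0) hle with h | ⟨ν, hν⟩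
    · obtain ⟨ν, k, hk, hex⟩ := h
      exact ⟨ν, k, by omega, hex⟩
    -- Such a run would give τ - 1 ≤ 200c with c = `costBound n m` ≥ 1, whereas τ > 1000c - 1.
    · have h2 := hν.length_le 𝒢.E_le hV hE hn hnm hm
      have h3 : ((τ - 1 : ℕ) : ℝ) = τ - 1 := by push_cast [hpos]; ring
      rw [h3] at h2
      linarith
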